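/- All graphs are finite and simple. A graph is \emph{1-planar} if it can be drawn in the plane so that each edge has at most one crossing. A \emph{1-planar packing} of graphs $G_1,\dots,G_k$, each with $n$ vertices, is a 1-planar graph on $n$ vertices that contains (isomorphic copies of) $G_1,\dots,G_k$ as pairwise edge-disjoint spanning subgraphs. A \emph{caterpillar} is a tree such that removing all its leaves (vertices of degree $1$) results in a path, called the \emph{spine}; a caterpillar $T$ is \emph{5-legged} if every vertex of its spine has degree either $2$ or at least $7$ in $T$. \textbf{Theorem.} Let $P_1$ and $P_2$ be paths with $n$ vertices and let $T$ be a 5-legged caterpillar with $n$ vertices. Then $P_1$, $P_2$ and $T$ admit a 1-planar packing if and only if $n \geq 6$ and $\deg_T(v) \leq n-3$ for every vertex $v$ of $T$. -/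

import Mathlib

namespace OnePlanarPacking

/-- `A` is a simple (Jordan) arc in the plane with end-points `p` and `q`. -/
def IsArc (A : Set (ℝ × ℝ)) (p q : ℝ × ℝ) : Prop :=
  ∃ γ : Path p q, Function.Injective γ ∧ Set.range γ = A

/-- A drawing of a graph in the plane: vertices are distinct points, every edge is a simple arc
joining its two end-vertices, and an edge passes through no other vertex. -/
structure Drawing {V : Type*} (G : SimpleGraph V) where
  pos : V → ℝ × ℝ
  pos_injective : Function.Injective pos
  arc : G.edgeSet → Set (ℝ × ℝ)
  isArc_arc : ∀ (u v : V) (h : G.Adj u v), IsArc (arc ⟨s(u, v), h⟩) (pos u) (pos v)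
  mem_of_pos_mem_arc : ∀ (e : G.edgeSet) (w : V), pos w ∈ arc e → w ∈ (e : Sym2 V)

/-- The crossings on the edge `e`: all pairs consisting of another edge `f` and a point, not a
vertex, common to `e` and `f`. (So three edges through one point give two crossings on each.) -/
def Drawing.crossings {V : Type*} {G : SimpleGraph V} (D : Drawing G) (e : G.edgeSet) :
    Set (G.edgeSet × (ℝ × ℝ)) :=
  {x | x.1 ≠ e ∧ x.2 ∈ D.arc e ∧ x.2 ∈ D.arc x.1 ∧ x.2 ∉ Set.range D.pos}

/-- `G` is 1-planar: it has a drawing in which each edge has at most one crossing. -/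
def IsOnePlanar {V : Type*} (G : SimpleGraph V) : Prop :=
  ∃ D : Drawing G, ∀ e : G.edgeSet, (D.crossings e).Subsingleton

/-- `G` is a packing of the graphs `F i`: it contains them (up to isomorphism) as pairwise
edge-disjoint spanning subgraphs. -/
def IsPacking {V : Type*} {k : ℕ} (F : Fin k → SimpleGraph V) (G : SimpleGraph V) : Prop :=
  ∃ H : Fin k → SimpleGraph V, (∀ i, Nonempty (F i ≃g H i)) ∧ (∀ i, H i ≤ G) ∧
    ∀ i j, i ≠ j → Disjoint (H i).edgeSet (H j).edgeSet

/-- The graphs `F i` admit a 1-planar packing. -/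
def AdmitsOnePlanarPacking {V : Type*} {k : ℕ} (F : Fin k → SimpleGraph V) : Prop :=
  ∃ G : SimpleGraph V, IsPacking F G ∧ IsOnePlanar G

/-- `G` is a path (as a graph). -/
def IsPathGraph {V : Type*} (G : SimpleGraph V) : Prop :=
  ∃ m : ℕ, Nonempty (G ≃g SimpleGraph.pathGraph m)

/-- The vertices of `T` that are not leaves; in a caterpillar these form the spine. -/
def spine {V : Type*} [Fintype V] (T : SimpleGraph V) [DecidableRel T.Adj] : Set V :=
  {v | T.degree v ≠ 1}

/-- A caterpillar: a tree in which removing all leaves results in a path. -/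
def IsCaterpillar {V : Type*} [Fintype V] (T : SimpleGraph V) [DecidableRel T.Adj] : Prop :=
  T.IsTree ∧ IsPathGraph (T.induce (spine T))

/-- An `h`-legged caterpillar: every spine vertex has degree `2` or at least `h + 2`. -/
def IsLeggedCaterpillar {V : Type*} [Fintype V] (h : ℕ) (T : SimpleGraph V)
    [DecidableRel T.Adj] : Prop :=
  IsCaterpillar T ∧ ∀ v ∈ spine T, T.degree v = 2 ∨ h + 2 ≤ T.degree v

end OnePlanarPacking

/-!
Why the theorem holds. If three connected graphs pack on `n` vertices, then they have at least
`3 (n - 1)` edges, which forces `n ≥ 6`, and at every vertex the two paths need at least one edge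
each, which leaves at most `n - 3` for the caterpillar. This is `card_and_degree_of_admits`, and it
does not use 1-planarity.

For the converse, the packing is drawn in two pages: the vertices lie on a line at the places
`0, 1, 2, …`, and each edge is an arc of a parabola above or below the line. Two edges then cross
only if they lie in the same page and their ends interleave, so 1-planarity becomes a condition on
finite lists of pairs of numbers (`isOnePlanar_of_pages`, `Realizable.admits`). A caterpillar is
read along its spine as a word of tags: `true` for the next spine vertex, `false` for a leaf at the
current spine vertex, the head.

The packing is built from left to right. A `Partial` packing occupies the places `0, …, u`; both
paths end at `u`, and in one of the pages no edge passes over the head `v`. All that a new edge can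
use of the old part is the head, in that page, the last place `u`, and the place `0`, which can be
reached without crossings from the places to the right of `u`. So a new edge never crosses an old
one, and a `Gadget`, a drawing of a bounded number of further vertices in terms of these three
places, can be glued on (`Partial.extend`, `Partial.complete`). Finitely many gadgets, whose
validity is decided by evaluation, suffice: blocks of five to nine leaves, the passage from one
vertex with legs to the next one over a short run of spine vertices of degree two, pieces of long
runs, and the two ends of the caterpillar.

The first vertex with legs can be a problem: a run of at least four vertices of degree two before
it leaves enough room to lead both paths through it at once, but otherwise its path neighbours have
to come late, since the first vertices drawn are its own leaves. It is then put at the place `0`,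
and the paths visit it when the packing is completed; a run of one to three vertices of degree two
before it is attached at that moment too. This works if the run at the other end is not longer, or
if there is no run before the first vertex and one of at most three vertices at the other end, and
up to reversing the spine one is always in one of these cases (`realizable_caterpillar`,
`IsLegList.realizable`). The degree bound excludes precisely the case of a single vertex with legs
that is joined to all but at most one of the other vertices.
-/

open SimpleGraph

namespace OnePlanarPacking

/-! ### Two-page drawings -/

/-- The part between `a` and `b` of the parabola `y = σ (x - a) (b - x)`. -/
def parabolaArc (σ a b : ℝ) : Set (ℝ × ℝ) :=
  {p | min a b ≤ p.1 ∧ p.1 ≤ max a b ∧ p.2 = σ * ((p.1 - a) * (b - p.1))}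

lemma parabolaArc_comm (σ a b : ℝ) : parabolaArc σ a b = parabolaArc σ b a := by
  ext p
  simp only [parabolaArc, Set.mem_ofPred_eq, min_comm a b, max_comm a b]
  rw [show (p.1 - a) * (b - p.1) = (p.1 - b) * (a - p.1) by ring]

lemma isArc_parabolaArc {σ a b : ℝ} (hab : a ≠ b) :
    IsArc (parabolaArc σ a b) (a, 0) (b, 0) := by
  have hba : b - a ≠ 0 := sub_ne_zero.2 hab.symm
  refine ⟨⟨⟨fun t => (a + t * (b - a), σ * (t * (1 - t) * (b - a) ^ 2)), by fun_prop⟩,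
    by simp, by simp⟩, ?_, ?_⟩
  · intro s t h
    have h1 : a + (s : ℝ) * (b - a) = a + t * (b - a) := congrArg Prod.fst h
    exact Subtype.ext (mul_right_cancel₀ hba (add_left_cancel h1))
  · ext ⟨x, y⟩
    constructor
    · rintro ⟨t, ht⟩
      have h1 : a + (t : ℝ) * (b - a) = x := congrArg Prod.fst ht
      have h2 : σ * ((t : ℝ) * (1 - t) * (b - a) ^ 2) = y := congrArg Prod.snd ht
      have t0 := t.2.1
      have t1 := t.2.2
      refine ⟨?_, ?_, ?_⟩
      · show min a b ≤ x
        rcases le_total a b with h | h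
        · rw [min_eq_left h]; nlinarith
        · rw [min_eq_right h]; nlinarith
      · show x ≤ max a b
        rcases le_total a b with h | h
        · rw [max_eq_right h]; nlinarith
        · rw [max_eq_left h]; nlinarith
      · show y = σ * ((x - a) * (b - x))
        rw [← h1, ← h2]; ring
    · rintro ⟨h1, h2, h3⟩
      change min a b ≤ x at h1
      change x ≤ max a b at h2
      change y = σ * ((x - a) * (b - x)) at h3
      have hx : (x - a) / (b - a) ∈ unitInterval := by
        rcases lt_or_gt_of_ne hab with h | h
        · rw [min_eq_left h.le] at h1
          rw [max_eq_right h.le] at h2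
          exact ⟨div_nonneg (by linarith) (by linarith),
            (div_le_one (by linarith)).2 (by linarith)⟩
        · rw [min_eq_right h.le] at h1
          rw [max_eq_left h.le] at h2
          exact ⟨div_nonneg_of_nonpos (by linarith) (by linarith),
            (div_le_one_of_neg (by linarith)).2 (by linarith)⟩
      refine ⟨⟨(x - a) / (b - a), hx⟩, ?_⟩
      refine Prod.ext ?_ ?_
      · show a + (x - a) / (b - a) * (b - a) = x
        field_simp; ring
      · show σ * ((x - a) / (b - a) * (1 - (x - a) / (b - a)) * (b - a) ^ 2) = y
        rw [h3]; field_simp; ring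

/-- If two parabola arcs over `[a, b]` and `[c, d]` meet away from the axis, then they lie on the
same side of the axis, the two intervals interleave unless they are equal, and the common point
is determined by a linear equation. -/
lemma parabolaArc_inter {σ τ a b c d : ℝ} (hσ : σ = 1 ∨ σ = -1) (hτ : τ = 1 ∨ τ = -1)
    (hab : a < b) (hcd : c < d) {p : ℝ × ℝ} (hp : p ∈ parabolaArc σ a b)
    (hq : p ∈ parabolaArc τ c d) (h0 : p.2 ≠ 0) :
    σ = τ ∧ p.1 * (a + b - c - d) = a * b - c * d ∧ a < p.1 ∧ p.1 < b ∧ c < p.1 ∧ p.1 < d := by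
  obtain ⟨x, y⟩ := p
  obtain ⟨h1, h2, h3⟩ := hp
  obtain ⟨k1, k2, k3⟩ := hq
  simp only [min_eq_left hab.le, max_eq_right hab.le, min_eq_left hcd.le,
    max_eq_right hcd.le] at *
  have ha : a ≠ x := by rintro rfl; exact h0 (by rw [h3]; ring)
  have hb : b ≠ x := by rintro rfl; exact h0 (by rw [h3]; ring)
  have hc : c ≠ x := by rintro rfl; exact h0 (by rw [k3]; ring)
  have hd : d ≠ x := by rintro rfl; exact h0 (by rw [k3]; ring)
  have ha' := lt_of_le_of_ne h1 ha
  have hb' := lt_of_le_of_ne h2 hb.symm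
  have hc' := lt_of_le_of_ne k1 hc
  have hd' := lt_of_le_of_ne k2 hd.symm
  have e1 : 0 < (x - a) * (b - x) := mul_pos (by linarith) (by linarith)
  have e2 : 0 < (x - c) * (d - x) := mul_pos (by linarith) (by linarith)
  have hst : σ = τ := by
    rcases hσ with rfl | rfl <;> rcases hτ with rfl | rfl <;> first | rfl | (exfalso; linarith)
  refine ⟨hst, ?_, ha', hb', hc', hd'⟩
  subst hst
  have hσ0 : σ ≠ 0 := by rcases hσ with rfl | rfl <;> norm_num
  have := mul_left_cancel₀ hσ0 (h3.symm.trans k3)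
  nlinarith

/-- In the drawing with the vertices at the places `x v` on a line and every edge in one of two
pages, the edges `e` and `f` cross: they lie in the same page and their ends interleave. -/
def PageCross {V : Type*} (x : V → ℕ) (page : Sym2 V → Bool) (e f : Sym2 V) : Prop :=
  page e = page f ∧ ∃ a b c d, x a < x c ∧ x c < x b ∧ x b < x d ∧
    ((e = s(a, b) ∧ f = s(c, d)) ∨ (f = s(a, b) ∧ e = s(c, d)))

/-- A two-page drawing in which every edge crosses at most one other edge certifies
1-planarity: the edges are drawn as arcs of parabolas above and below the line. -/
theorem isOnePlanar_of_pages {V : Type*} (G : SimpleGraph V) (x : V → ℕ)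
    (hx : Function.Injective x) (page : Sym2 V → Bool)
    (h : ∀ e ∈ G.edgeSet, ∀ f ∈ G.edgeSet, ∀ g ∈ G.edgeSet,
      PageCross x page e f → PageCross x page e g → f = g) :
    IsOnePlanar G := by
  set σ : Sym2 V → ℝ := fun e => if page e then 1 else -1 with hσdef
  have hσ : ∀ e, σ e = 1 ∨ σ e = -1 := by
    intro e; simp only [hσdef]; split <;> simp
  have hσ0 : ∀ e, σ e ≠ 0 := by
    intro e; rcases hσ e with h | h <;> rw [h] <;> norm_num
  have hσp : ∀ e f, σ e = σ f → page e = page f := by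
    intro e f hef
    simp only [hσdef] at hef
    cases h1 : page e <;> cases h2 : page f <;> simp [h1, h2] at hef ⊢ <;> norm_num at hef
  let A : Sym2 V → Set (ℝ × ℝ) := fun e =>
    {p | ∃ u v, e = s(u, v) ∧ p ∈ parabolaArc (σ e) (x u) (x v)}
  have hA : ∀ u v, A s(u, v) = parabolaArc (σ s(u, v)) (x u) (x v) := by
    intro u v
    ext p
    constructor
    · rintro ⟨u', v', he, hp⟩
      rcases Sym2.eq_iff.1 he with ⟨rfl, rfl⟩ | ⟨rfl, rfl⟩
      · exact hp
      · rwa [parabolaArc_comm]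
    · exact fun hp => ⟨u, v, rfl, hp⟩
  have hxne : ∀ {u v}, u ≠ v → (x u : ℝ) ≠ x v := fun huv hh =>
    huv (hx (by exact_mod_cast hh))
  let D : Drawing G :=
    { pos := fun v => ((x v : ℝ), 0)
      pos_injective := fun u v huv =>
        hx (Nat.cast_injective (congrArg Prod.fst huv : (x u : ℝ) = x v))
      arc := fun e => A e
      isArc_arc := fun u v huv => by
        show IsArc (A s(u, v)) _ _
        rw [hA]
        exact isArc_parabolaArc (hxne huv.ne)
      mem_of_pos_mem_arc := by
        rintro ⟨e, he⟩ w hw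
        induction e with | _ u v =>
        change _ ∈ A s(u, v) at hw
        rw [hA] at hw
        have h3 : (0 : ℝ) = σ s(u, v) * (((x w : ℝ) - x u) * (x v - x w)) := hw.2.2
        rcases mul_eq_zero.1 h3.symm with h4 | h4
        · exact absurd h4 (hσ0 _)
        rcases mul_eq_zero.1 h4 with h5 | h5
        · have : w = u := hx (by exact_mod_cast sub_eq_zero.1 h5)
          simp [this]
        · have : w = v := hx (by exact_mod_cast (sub_eq_zero.1 h5).symm)
          simp [this] }
  -- every edge can be written with its ends in the order of the line
  have hord : ∀ e ∈ G.edgeSet, ∃ u v, e = s(u, v) ∧ x u < x v := by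
    intro e he
    induction e with | _ u v =>
    have huv : u ≠ v := G.ne_of_adj he
    rcases lt_or_gt_of_ne (hx.ne huv) with h' | h'
    · exact ⟨u, v, rfl, h'⟩
    · exact ⟨v, u, Sym2.eq_swap, h'⟩
  have key : ∀ e ∈ G.edgeSet, ∀ f ∈ G.edgeSet, e ≠ f → ∀ p, p ∈ A e → p ∈ A f →
      p ∉ Set.range D.pos → PageCross x page e f ∧ ∀ q, q ∈ A e → q ∈ A f →
      q ∉ Set.range D.pos → p = q := by
    intro e he f hf hef
    obtain ⟨a, b, rfl, hab⟩ := hord e he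
    obtain ⟨c, d, rfl, hcd⟩ := hord f hf
    have hab' : (x a : ℝ) < x b := by exact_mod_cast hab
    have hcd' : (x c : ℝ) < x d := by exact_mod_cast hcd
    have h0 : ∀ p, p ∈ A s(a, b) → p ∉ Set.range D.pos → p.2 ≠ 0 := by
      rintro ⟨X, Y⟩ hp hpv h0
      rw [hA] at hp
      have h3 : Y = σ s(a, b) * ((X - x a) * (x b - X)) := hp.2.2
      change Y = 0 at h0
      subst h0
      rcases mul_eq_zero.1 h3.symm with h4 | h4
      · exact hσ0 _ h4
      rcases mul_eq_zero.1 h4 with h5 | h5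
      · exact hpv ⟨a, Prod.ext (sub_eq_zero.1 h5).symm rfl⟩
      · exact hpv ⟨b, Prod.ext (sub_eq_zero.1 h5) rfl⟩
    have hmain : ∀ p, p ∈ A s(a, b) → p ∈ A s(c, d) → p ∉ Set.range D.pos → _ :=
      fun p hp hq hpv => parabolaArc_inter (hσ _) (hσ _) hab' hcd' (by rwa [← hA])
        (by rwa [← hA]) (h0 p hp hpv)
    intro p hp hq hpv
    obtain ⟨hs, hl, h1, h2, h3, h4⟩ := hmain p hp hq hpv
    have hne : ¬ ((x a : ℝ) + x b - x c - x d = 0) := by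
      intro hz
      rw [hz, mul_zero] at hl
      have : ((x a : ℝ) - x c) * (x a - x d) = 0 := by
        have : (x b : ℝ) = x c + x d - x a := by linarith
        rw [this] at hl; nlinarith
      rcases mul_eq_zero.1 this with h5 | h5
      · have e1 : a = c := hx (by exact_mod_cast sub_eq_zero.1 h5)
        have e2 : b = d := hx (by
          have : (x b : ℝ) = x d := by linarith
          exact_mod_cast this)
        exact hef (by rw [e1, e2])
      · linarith
    refine ⟨⟨hσp _ _ hs, ?_⟩, ?_⟩
    · obtain ⟨X, Y⟩ := p
      obtain ⟨-, -, e1⟩ := (hA a b ▸ hp : _ ∈ parabolaArc _ _ _)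
      obtain ⟨-, -, e2⟩ := (hA c d ▸ hq : _ ∈ parabolaArc _ _ _)
      simp only at h1 h2 h3 h4 e1 e2 hl
      have hX : ∀ {y z : V}, (x y : ℝ) < X → X < x z → x y < x z := fun h h' => by
        exact_mod_cast h.trans h'
      -- nested or equal intervals would force one parabola strictly above the other
      rcases lt_trichotomy (x a) (x c) with hac | hac | hac
      · refine ⟨a, b, c, d, hac, hX h3 h2, ?_, Or.inl ⟨rfl, rfl⟩⟩
        by_contra hdb
        have hac' : (x a : ℝ) < x c := by exact_mod_cast hac
        have hdb' : (x d : ℝ) ≤ x b := by exact_mod_cast not_lt.1 hdb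
        nlinarith [mul_pos (sub_pos.2 hac') (sub_pos.2 h4),
          mul_nonneg (sub_nonneg.2 hdb') (sub_pos.2 h1).le]
      · exfalso
        have hac' : (x a : ℝ) = x c := by exact_mod_cast hac
        have : (X - x a) * ((x b : ℝ) - x d) = 0 := by rw [← hac'] at hl; nlinarith
        rcases mul_eq_zero.1 this with h5 | h5
        · linarith
        · exact hne (by linarith)
      · refine ⟨c, d, a, b, hac, hX h1 h4, ?_, Or.inr ⟨rfl, rfl⟩⟩
        by_contra hdb
        have hac' : (x c : ℝ) < x a := by exact_mod_cast hac
        have hdb' : (x b : ℝ) ≤ x d := by exact_mod_cast not_lt.1 hdb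
        nlinarith [mul_pos (sub_pos.2 hac') (sub_pos.2 h2),
          mul_nonneg (sub_nonneg.2 hdb') (sub_pos.2 h3).le]
    · intro q hp' hq' hqv
      obtain ⟨-, hl', -⟩ := hmain q hp' hq' hqv
      have h1 : p.1 = q.1 := mul_right_cancel₀ hne (hl.trans hl'.symm)
      refine Prod.ext h1 ?_
      have e1 := (hA a b ▸ hp : _ ∈ parabolaArc _ _ _).2.2
      have e2 := (hA a b ▸ hp' : _ ∈ parabolaArc _ _ _).2.2
      rw [e1, e2, h1]
  refine ⟨D, ?_⟩
  rintro ⟨e, he⟩ ⟨⟨f, hf⟩, p⟩ ⟨hfe, hpe, hpf, hpv⟩ ⟨⟨g, hg⟩, q⟩ ⟨hge, hqe, hqg, hqv⟩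
  have hef : e ≠ f := fun hh => hfe (Subtype.ext hh.symm)
  have heg : e ≠ g := fun hh => hge (Subtype.ext hh.symm)
  obtain ⟨c1, u1⟩ := key e he f hf hef p hpe hpf hpv
  obtain ⟨c2, -⟩ := key e he g hg heg q hqe hqg hqv
  have hfg := h e he f hf g hg c1 c2
  subst hfg
  rw [u1 q hqe hqg hqv]

/-! ### Necessity: counting edges and degrees -/

lemma IsPathGraph.connected {V : Type*} [Nonempty V] {G : SimpleGraph V} (h : IsPathGraph G) :
    G.Connected := by
  obtain ⟨m, ⟨φ⟩⟩ := h
  exact ⟨φ.preconnected_iff.2 (pathGraph_preconnected m)⟩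

/-- Three connected graphs that pack have at least `3 (n - 1)` edges together, and at every vertex
each of them has an edge. -/
lemma IsPacking.card_and_degree {V : Type*} [Fintype V] {P₁ P₂ T G : SimpleGraph V}
    [DecidableRel T.Adj] (hP₁ : P₁.Connected) (hP₂ : P₂.Connected) (hT : T.Connected)
    (h : IsPacking ![P₁, P₂, T] G) (hV : 2 ≤ Fintype.card V) :
    6 ≤ Fintype.card V ∧ ∀ v : V, T.degree v ≤ Fintype.card V - 3 := by
  classical
  obtain ⟨H, hiso, -, hdisj⟩ := h
  obtain ⟨i0⟩ := hiso 0
  obtain ⟨i1⟩ := hiso 1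
  obtain ⟨i2⟩ := hiso 2
  change P₁ ≃g H 0 at i0
  change P₂ ≃g H 1 at i1
  change T ≃g H 2 at i2
  have c0 : (H 0).Connected := i0.connected_iff.1 hP₁
  have c1 : (H 1).Connected := i1.connected_iff.1 hP₂
  have c2 : (H 2).Connected := i2.connected_iff.1 hT
  have d : ∀ i j, i ≠ j → Disjoint (H i).edgeFinset (H j).edgeFinset := fun i j hij =>
    disjoint_edgeFinset.2 (disjoint_edgeSet.1 (hdisj i j hij))
  constructor
  · have hc : ∀ i, (H i).Connected → Fintype.card V ≤ (H i).edgeFinset.card + 1 := by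
      intro i hi
      have := hi.card_vert_le_card_edgeSet_add_one
      rwa [Nat.card_eq_fintype_card, Nat.card_eq_fintype_card, ← edgeFinset_card] at this
    have h01 := d 0 1 (by decide)
    have h2 : Disjoint ((H 0).edgeFinset ∪ (H 1).edgeFinset) (H 2).edgeFinset :=
      Finset.disjoint_union_left.2 ⟨d 0 2 (by decide), d 1 2 (by decide)⟩
    have hle : (H 0).edgeFinset.card + (H 1).edgeFinset.card + (H 2).edgeFinset.card
        ≤ (Fintype.card V).choose 2 := by
      rw [← Finset.card_union_of_disjoint h01, ← Finset.card_union_of_disjoint h2,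
        ← card_edgeFinset_top_eq_card_choose_two]
      apply Finset.card_le_card
      refine Finset.union_subset (Finset.union_subset ?_ ?_) ?_ <;>
        exact edgeFinset_subset_edgeFinset.2 le_top
    have a0 := hc 0 c0
    have a1 := hc 1 c1
    have a2 := hc 2 c2
    by_contra hn
    have hn : Fintype.card V ≤ 5 := by omega
    generalize Fintype.card V = n at *
    interval_cases n <;> simp [Nat.choose] at hle <;> omega
  · have : Nontrivial V := Fintype.one_lt_card_iff_nontrivial.1 (by omega)
    intro w
    rw [← i2.degree_eq w]
    set v := i2 w
    have hd : ∀ i j, i ≠ j → Disjoint ((H i).neighborFinset v) ((H j).neighborFinset v) := by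
      intro i j hij
      rw [Finset.disjoint_left]
      intro u hu hu'
      rw [mem_neighborFinset] at hu hu'
      exact Set.disjoint_left.1 (hdisj i j hij) ((mem_edgeSet _).2 hu) ((mem_edgeSet _).2 hu')
    have h2 : Disjoint ((H 0).neighborFinset v ∪ (H 1).neighborFinset v)
        ((H 2).neighborFinset v) :=
      Finset.disjoint_union_left.2 ⟨hd 0 2 (by decide), hd 1 2 (by decide)⟩
    have hv : v ∉ (H 0).neighborFinset v ∪ (H 1).neighborFinset v ∪ (H 2).neighborFinset v := by
      simp
    have hcard := Finset.card_lt_univ_of_notMem hv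
    rw [Finset.card_union_of_disjoint h2, Finset.card_union_of_disjoint (hd 0 1 (by decide)),
      card_neighborFinset_eq_degree, card_neighborFinset_eq_degree,
      card_neighborFinset_eq_degree] at hcard
    have p0 := c0.preconnected.degree_pos_of_nontrivial v
    have p1 := c1.preconnected.degree_pos_of_nontrivial v
    omega

lemma IsLeggedCaterpillar.two_le_card {V : Type*} [Fintype V] {h : ℕ} {T : SimpleGraph V}
    [DecidableRel T.Adj] (hT : IsLeggedCaterpillar h T) : 2 ≤ Fintype.card V := by
  have : Nonempty V := hT.1.1.1.nonempty
  by_contra hV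
  have h1 : Fintype.card V = 1 := by have := Fintype.card_pos (α := V); omega
  obtain ⟨v, hv⟩ := Fintype.card_eq_one_iff.1 h1
  have h0 : T.degree v = 0 := by
    have := T.degree_lt_card_verts v
    omega
  have := hT.2 v (by simp [spine, h0])
  omega

/-- The necessity of the two conditions. -/
lemma card_and_degree_of_admits {V : Type*} [Fintype V] {P₁ P₂ T : SimpleGraph V}
    [DecidableRel T.Adj] (hP₁ : IsPathGraph P₁) (hP₂ : IsPathGraph P₂) {h : ℕ}
    (hT : IsLeggedCaterpillar h T)
    (hp : AdmitsOnePlanarPacking ![P₁, P₂, T]) :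
    6 ≤ Fintype.card V ∧ ∀ v : V, T.degree v ≤ Fintype.card V - 3 := by
  obtain ⟨G, hG, -⟩ := hp
  have : Nonempty V := hT.1.1.1.nonempty
  exact hG.card_and_degree hP₁.connected hP₂.connected hT.1.1.1 hT.two_le_card

/-! ### Caterpillars and paths as lists -/

/-- The edges of the caterpillar that grows from the vertex `h` by attaching, one after the
other, the vertices of a tagged list to the current head; a vertex with the tag `true` becomes
the new head (the next vertex of the spine), one with the tag `false` is a leaf. -/
def treeEdges {α : Type*} : α → List (Bool × α) → List (α × α)
  | _, [] => []
  | h, (s, x) :: r => (h, x) :: treeEdges (if s then x else h) r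

/-- The head after all vertices of a tagged list have been attached. -/
def lastHead {α : Type*} : α → List (Bool × α) → α
  | h, [] => h
  | h, (s, x) :: r => lastHead (if s then x else h) r

/-- The edges of the path that visits the vertices of a list in order. -/
def pathEdges {α : Type*} (l : List α) : List (α × α) := l.zip l.tail

/-- An edge with its ends in increasing order. -/
def norm (e : ℕ × ℕ) : ℕ × ℕ := (min e.1 e.2, max e.1 e.2)

/-- Two drawn edges (ends in increasing order, and the page) cross. -/
def Cross (e f : (ℕ × ℕ) × Bool) : Prop :=
  e.2 = f.2 ∧ (e.1.1 < f.1.1 ∧ f.1.1 < e.1.2 ∧ e.1.2 < f.1.2 ∨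
    f.1.1 < e.1.1 ∧ e.1.1 < f.1.2 ∧ f.1.2 < e.1.2)

/-- Every drawn edge crosses at most one other drawn edge. -/
def OneCross (D : List ((ℕ × ℕ) × Bool)) : Prop :=
  ∀ e ∈ D, ∀ f ∈ D, ∀ g ∈ D, Cross e f → Cross e g → f = g

/-- The caterpillar with the tags `w` has a two-page packing with two paths: its vertices, put on
the places `0, …, w.length`, form the tagged list `x₀, r`, the paths visit `p` and `q`, the three
graphs are edge-disjoint, and `D` draws all their edges with at most one crossing each. -/
def Realizable (w : List Bool) : Prop :=
  ∃ (x₀ : ℕ) (r : List (Bool × ℕ)) (p q : List ℕ) (D : List ((ℕ × ℕ) × Bool)),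
    r.map Prod.fst = w ∧ (x₀ :: r.map Prod.snd).Perm (List.range (w.length + 1)) ∧
    p.Perm (List.range (w.length + 1)) ∧ q.Perm (List.range (w.length + 1)) ∧
    ((treeEdges x₀ r ++ pathEdges p ++ pathEdges q).map norm).Nodup ∧
    (∀ e ∈ treeEdges x₀ r ++ pathEdges p ++ pathEdges q, ∃ s, (norm e, s) ∈ D) ∧
    OneCross D

lemma norm_swap (a b : ℕ) : norm (a, b) = norm (b, a) := by
  simp [norm, min_comm, max_comm]

lemma treeEdges_append {α : Type*} (h : α) (r r' : List (Bool × α)) :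
    treeEdges h (r ++ r') = treeEdges h r ++ treeEdges (lastHead h r) r' := by
  induction r generalizing h with
  | nil => rfl
  | cons a r ih => obtain ⟨s, x⟩ := a; simp [treeEdges, lastHead, ih]

lemma lastHead_append {α : Type*} (h : α) (r r' : List (Bool × α)) :
    lastHead h (r ++ r') = lastHead (lastHead h r) r' := by
  induction r generalizing h with
  | nil => rfl
  | cons a r ih => obtain ⟨s, x⟩ := a; simp [lastHead, ih]

lemma treeEdges_map {α β : Type*} (f : α → β) (h : α) (r : List (Bool × α)) :
    treeEdges (f h) (r.map (Prod.map id f)) = (treeEdges h r).map (Prod.map f f) := by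
  induction r generalizing h with
  | nil => rfl
  | cons a r ih => obtain ⟨s, x⟩ := a; cases s <;> simp [treeEdges, ih]

lemma lastHead_map {α β : Type*} (f : α → β) (h : α) (r : List (Bool × α)) :
    lastHead (f h) (r.map (Prod.map id f)) = f (lastHead h r) := by
  induction r generalizing h with
  | nil => rfl
  | cons a r ih => obtain ⟨s, x⟩ := a; cases s <;> simp [lastHead, ih]

lemma pathEdges_map {α β : Type*} (f : α → β) (l : List α) :
    pathEdges (l.map f) = (pathEdges l).map (Prod.map f f) := by
  rw [pathEdges, pathEdges, ← List.map_tail, List.zip_map]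

lemma pathEdges_cons_cons {α : Type*} (a b : α) (l : List α) :
    pathEdges (a :: b :: l) = (a, b) :: pathEdges (b :: l) := rfl

lemma pathEdges_append {α : Type*} (l : List α) (a : α) (l' : List α) :
    pathEdges (l ++ a :: l') = pathEdges (l ++ [a]) ++ pathEdges (a :: l') := by
  induction l with
  | nil => rfl
  | cons b l ih =>
    cases l with
    | nil => rfl
    | cons c l => simpa [pathEdges_cons_cons] using ih

lemma mem_of_mem_pathEdges {α : Type*} {l : List α} {e : α × α} (he : e ∈ pathEdges l) :
    e.1 ∈ l ∧ e.2 ∈ l :=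
  ⟨(List.of_mem_zip he).1, List.mem_of_mem_tail (List.of_mem_zip he).2⟩

lemma mem_pathEdges_iff {α : Type*} {l : List α} {a b : α} :
    (a, b) ∈ pathEdges l ↔ ∃ (i : ℕ) (h : i + 1 < l.length), l[i] = a ∧ l[i + 1] = b := by
  constructor
  · intro h
    obtain ⟨i, hi, h⟩ := List.mem_iff_getElem.1 h
    simp only [pathEdges, List.length_zip, List.length_tail] at hi
    simp only [pathEdges, List.getElem_zip, List.getElem_tail, Prod.mk.injEq] at h
    exact ⟨i, by omega, h⟩
  · rintro ⟨i, h, rfl, rfl⟩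
    refine List.mem_iff_getElem.2 ⟨i, ?_, ?_⟩
    · simp [pathEdges]; omega
    · simp [pathEdges]

/-- The graph that visits all vertices along a list is a path. -/
lemma nonempty_iso_pathGraph {V : Type*} {l : List V} (hl : l.Nodup) (hm : ∀ v, v ∈ l)
    {G : SimpleGraph V} (hG : ∀ a b, G.Adj a b ↔ (a, b) ∈ pathEdges l ∨ (b, a) ∈ pathEdges l) :
    Nonempty (pathGraph l.length ≃g G) := by
  classical
  refine ⟨⟨hl.getEquivOfForallMemList l hm, ?_⟩⟩
  intro i j
  rw [hG, mem_pathEdges_iff, mem_pathEdges_iff, pathGraph_adj]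
  have key : ∀ i j : Fin l.length, (∃ (k : ℕ) (h : k + 1 < l.length), l[k] = l.get i ∧
      l[k + 1] = l.get j) ↔ i.val + 1 = j.val := by
    intro i j
    constructor
    · rintro ⟨k, hk, h1, h2⟩
      have e1 : k = i := hl.getElem_inj_iff.1 h1
      have e2 : k + 1 = j := hl.getElem_inj_iff.1 h2
      omega
    · intro h
      refine ⟨i, by omega, rfl, ?_⟩
      simp [h]
  exact or_congr (key i j) (key j i)

/-- A packing of abstract caterpillars `treeEdges` transfers to every graph with the same tags. -/
theorem Realizable.admits {V : Type*} [Fintype V] {P₁ P₂ T : SimpleGraph V} {w : List Bool}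
    (hw : Realizable w) (hP₁ : IsPathGraph P₁) (hP₂ : IsPathGraph P₂) {y₀ : V}
    {ρ : List (Bool × V)} (hρ : ρ.map Prod.fst = w) (hnd : (y₀ :: ρ.map Prod.snd).Nodup)
    (hall : ∀ v, v ∈ y₀ :: ρ.map Prod.snd)
    (hT : ∀ a b, T.Adj a b ↔ (a, b) ∈ treeEdges y₀ ρ ∨ (b, a) ∈ treeEdges y₀ ρ) :
    AdmitsOnePlanarPacking ![P₁, P₂, T] := by
  classical
  obtain ⟨x₀, r, p, q, D, hr, hx, hp, hq, hE, hD, hcr⟩ := hw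
  have : Nonempty V := ⟨y₀⟩
  set Y := y₀ :: ρ.map Prod.snd with hY
  set X := x₀ :: r.map Prod.snd with hX
  have hlen : X.length = Y.length := by
    have : r.length = ρ.length := by simpa using congrArg List.length (hr.trans hρ.symm)
    simp [hX, hY, this]
  have hYn : Y.length = w.length + 1 := by simp [hY, ← hρ]
  have hcard : Fintype.card V = Y.length := by
    simpa using (Fintype.card_congr (hnd.getEquivOfForallMemList Y hall)).symm
  have hXnd : X.Nodup := hx.nodup_iff.2 List.nodup_range
  -- the place of a vertex on the line
  let x : V → ℕ := fun v => X.getD (Y.idxOf v) 0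
  have hidx : ∀ v, Y.idxOf v < X.length := fun v => by
    rw [hlen]; exact List.idxOf_lt_length_of_mem (hall v)
  have hxe : ∀ v, x v = X[Y.idxOf v]'(hidx v) := fun v => List.getD_eq_getElem _ _ (hidx v)
  have hinj : Function.Injective x := by
    intro u v huv
    rw [hxe, hxe] at huv
    have := hXnd.getElem_inj_iff.1 huv
    exact (List.idxOf_inj (hall u)).1 this
  have hYX : Y.map x = X := by
    apply List.ext_getElem (by simp [hlen])
    intro i h1 h2
    rw [List.getElem_map, hxe]
    congr 1
    exact hnd.idxOf_getElem i _
  have hx₀ : x y₀ = x₀ := by simpa [hX, hY] using congrArg List.head? hYX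
  have hrρ : ρ.map (Prod.map id x) = r := by
    have h2 : (ρ.map (Prod.map id x)).map Prod.snd = r.map Prod.snd := by
      have := congrArg List.tail hYX
      simpa [hX, hY, Function.comp_def] using this
    have h1 : (ρ.map (Prod.map id x)).map Prod.fst = r.map Prod.fst := by
      rw [hr, ← hρ]; simp [Function.comp_def]
    exact (List.zip_of_prod h1 h2).trans (List.zip_of_prod rfl rfl).symm
  have hTE : treeEdges x₀ r = (treeEdges y₀ ρ).map (Prod.map x x) := by
    rw [← hx₀, ← hrρ, treeEdges_map]
  have hpair : Function.Injective (Prod.map x x) := hinj.prodMap hinj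
  have hT' : ∀ a b, T.Adj a b ↔ (x a, x b) ∈ treeEdges x₀ r ∨ (x b, x a) ∈ treeEdges x₀ r := by
    intro a b
    rw [hT, hTE]
    have : ∀ a b, (x a, x b) ∈ (treeEdges y₀ ρ).map (Prod.map x x) ↔ (a, b) ∈ treeEdges y₀ ρ :=
      fun a b => List.mem_map_of_injective hpair (a := (a, b))
    rw [this, this]
  have hrange : ∀ k, k < w.length + 1 → ∃ v, x v = k := by
    intro k hk
    have : k ∈ Y.map x := by rw [hYX, hx.mem_iff]; exact List.mem_range.2 hk
    obtain ⟨v, -, hv⟩ := List.mem_map.1 this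
    exact ⟨v, hv⟩
  -- the path along a list of places
  let H : List ℕ → SimpleGraph V := fun l =>
    { Adj := fun a b => a ≠ b ∧ ((x a, x b) ∈ pathEdges l ∨ (x b, x a) ∈ pathEdges l)
      symm := ⟨fun a b h => ⟨h.1.symm, h.2.symm⟩⟩
      loopless := ⟨fun a h => h.1 rfl⟩ }
  have hiso : ∀ (P : SimpleGraph V), IsPathGraph P → ∀ l : List ℕ,
      l.Perm (List.range (w.length + 1)) → Nonempty (P ≃g H l) := by
    rintro P ⟨m, ⟨φ⟩⟩ l hl
    have hlnd : l.Nodup := hl.nodup_iff.2 List.nodup_range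
    let l' := l.map (Function.invFun x)
    have hl' : l'.map x = l := by
      rw [List.map_map]
      conv_rhs => rw [← List.map_id l]
      apply List.map_congr_left
      intro k hk
      exact Function.invFun_eq (hrange k (List.mem_range.1 (hl.mem_iff.1 hk)))
    have hnd' : l'.Nodup := List.Nodup.of_map x (hl' ▸ hlnd)
    have hm : ∀ v, v ∈ l' := by
      intro v
      have : x v ∈ l'.map x := by
        rw [hl', hl.mem_iff, ← hx.mem_iff, hxe]
        exact List.getElem_mem _
      exact (List.mem_map_of_injective hinj).1 this
    obtain ⟨ψ⟩ := nonempty_iso_pathGraph hnd' hm (G := H l) (by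
      intro a b
      have : ∀ a b, (x a, x b) ∈ pathEdges l ↔ (a, b) ∈ pathEdges l' := by
        intro a b
        rw [← hl', pathEdges_map]
        exact List.mem_map_of_injective hpair (a := (a, b))
      show (a ≠ b ∧ _) ↔ _
      rw [this, this, and_iff_right_iff_imp]
      rintro h rfl
      have h : (a, a) ∈ pathEdges l' := by simpa using h
      obtain ⟨i, hi, h1, h2⟩ := mem_pathEdges_iff.1 h
      have := hnd'.getElem_inj_iff.1 (h1.trans h2.symm)
      omega)
    have hm' : m = l'.length := by
      have h1 := Fintype.card_congr φ.toEquiv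
      have h2 := Fintype.card_congr ψ.toEquiv
      simp at h1 h2
      omega
    subst hm'
    exact ⟨φ.trans ψ⟩
  have hmem : ∀ {a b : V} {E : List (ℕ × ℕ)}, ((x a, x b) ∈ E ∨ (x b, x a) ∈ E) →
      norm (x a, x b) ∈ E.map norm := by
    rintro a b E (h | h)
    · exact List.mem_map.2 ⟨_, h, rfl⟩
    · exact List.mem_map.2 ⟨_, h, norm_swap _ _⟩
  rw [List.map_append, List.map_append, List.nodup_append, List.nodup_append] at hE
  obtain ⟨⟨-, -, hd1⟩, -, hd2⟩ := hE
  have dTp : Disjoint T.edgeSet (H p).edgeSet := by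
    rw [Set.disjoint_left]
    intro e he he'
    induction e with | _ a b =>
    exact hd1 _ (hmem ((hT' a b).1 he)) _ (hmem he'.2) rfl
  have dTq : Disjoint T.edgeSet (H q).edgeSet := by
    rw [Set.disjoint_left]
    intro e he he'
    induction e with | _ a b =>
    exact hd2 _ (List.mem_append_left _ (hmem ((hT' a b).1 he))) _ (hmem he'.2) rfl
  have dpq : Disjoint (H p).edgeSet (H q).edgeSet := by
    rw [Set.disjoint_left]
    intro e he he'
    induction e with | _ a b =>
    exact hd2 _ (List.mem_append_right _ (hmem he.2)) _ (hmem he'.2) rfl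
  refine ⟨H p ⊔ H q ⊔ T, ⟨![H p, H q, T], ?_, ?_, ?_⟩, ?_⟩
  · intro i
    fin_cases i
    · exact hiso P₁ hP₁ p hp
    · exact hiso P₂ hP₂ q hq
    · exact ⟨SimpleGraph.Iso.refl⟩
  · intro i
    fin_cases i
    · exact le_sup_of_le_left le_sup_left
    · exact le_sup_of_le_left le_sup_right
    · exact le_sup_right
  · intro i j hij
    fin_cases i <;> fin_cases j <;> first
      | exact absurd rfl hij
      | exact dpq
      | exact dpq.symm
      | exact dTp
      | exact dTp.symm
      | exact dTq
      | exact dTq.symm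
  · let page : Sym2 V → Bool := fun z =>
      decide (∃ a b, z = s(a, b) ∧ (norm (x a, x b), true) ∈ D)
    have hpage : ∀ a b, s(a, b) ∈ (H p ⊔ H q ⊔ T).edgeSet → x a < x b →
        ((x a, x b), page s(a, b)) ∈ D := by
      intro a b hab hlt
      have hnorm : norm (x a, x b) = (x a, x b) := by
        simp [norm, min_eq_left hlt.le, max_eq_right hlt.le]
      cases hpg : page s(a, b) with
      | true =>
        obtain ⟨a', b', he, hm⟩ := of_decide_eq_true hpg
        rcases Sym2.eq_iff.1 he with ⟨rfl, rfl⟩ | ⟨rfl, rfl⟩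
        · rwa [hnorm] at hm
        · rwa [norm_swap, hnorm] at hm
      | false =>
        have hne := of_decide_eq_false hpg
        obtain ⟨e, he, hen⟩ : ∃ e ∈ treeEdges x₀ r ++ pathEdges p ++ pathEdges q,
            norm e = norm (x a, x b) := by
          have : (H p).Adj a b ∨ (H q).Adj a b ∨ T.Adj a b := by
            simpa [or_assoc] using hab
          rw [List.append_assoc]
          rcases this with h | h | h
          · obtain ⟨e, he, h'⟩ := List.mem_map.1 (hmem h.2)
            exact ⟨e, by simp [he], h'⟩
          · obtain ⟨e, he, h'⟩ := List.mem_map.1 (hmem h.2)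
            exact ⟨e, by simp [he], h'⟩
          · obtain ⟨e, he, h'⟩ := List.mem_map.1 (hmem ((hT' a b).1 h))
            exact ⟨e, by simp [he], h'⟩
        obtain ⟨s, hs⟩ := hD e he
        cases s with
        | true => exact absurd ⟨a, b, rfl, by rwa [hen] at hs⟩ hne
        | false => rwa [hen, hnorm] at hs
    refine isOnePlanar_of_pages _ x hinj page ?_
    -- every crossing of the drawing is one of `D`
    have hcross : ∀ a b, s(a, b) ∈ (H p ⊔ H q ⊔ T).edgeSet → x a < x b → ∀ f ∈
        (H p ⊔ H q ⊔ T).edgeSet, PageCross x page s(a, b) f → ∃ c d, f = s(c, d) ∧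
        ((x c, x d), page f) ∈ D ∧ Cross ((x a, x b), page s(a, b)) ((x c, x d), page f) := by
      rintro a b hab hlt f hf ⟨hpg, a', b', c', d', h1, h2, h3, ⟨he, rfl⟩ | ⟨rfl, he⟩⟩
      · have : a = a' ∧ b = b' := by
          rcases Sym2.eq_iff.1 he with h | ⟨rfl, rfl⟩
          · exact h
          · omega
        obtain ⟨rfl, rfl⟩ := this
        exact ⟨c', d', rfl, hpage _ _ hf (by omega), hpg, Or.inl ⟨h1, h2, h3⟩⟩
      · have : a = c' ∧ b = d' := by
          rcases Sym2.eq_iff.1 he with h | ⟨rfl, rfl⟩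
          · exact h
          · omega
        obtain ⟨rfl, rfl⟩ := this
        exact ⟨a', b', rfl, hpage _ _ hf (by omega), hpg, Or.inr ⟨h1, h2, h3⟩⟩
    intro e he f hf g hg hef heg
    obtain ⟨a, b, rfl, hlt⟩ : ∃ a b, e = s(a, b) ∧ x a < x b := by
      induction e with | _ a b =>
      have hne : a ≠ b := (H p ⊔ H q ⊔ T).ne_of_adj he
      rcases lt_or_gt_of_ne (hinj.ne hne) with h | h
      · exact ⟨a, b, rfl, h⟩
      · exact ⟨b, a, Sym2.eq_swap, h⟩
    obtain ⟨c, d, rfl, hm1, hc1⟩ := hcross a b he hlt f hf hef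
    obtain ⟨c', d', rfl, hm2, hc2⟩ := hcross a b he hlt g hg heg
    have := hcr _ (hpage a b he hlt) _ hm1 _ hm2 hc1 hc2
    simp only [Prod.mk.injEq] at this
    rw [hinj this.1.1, hinj this.1.2]

/-! ### Partial packings and gadgets -/

/-- A partial two-page packing on the places `0, …, w.length`. The caterpillar so far has the
tags `w` and the head `v`, both paths end at the last place, and no edge in the page `side` passes
over `v`. If `c = 1`, then the place `0` holds the first vertex of the caterpillar and is still
missing in the two paths; if `c = 0`, the paths visit all places. -/
structure Partial (c : ℕ) (w : List Bool) (x₀ : ℕ) (r : List (Bool × ℕ)) (p q : List ℕ)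
    (D : List ((ℕ × ℕ) × Bool)) (v : ℕ) (side : Bool) : Prop where
  tags : r.map Prod.fst = w
  perm : (x₀ :: r.map Prod.snd).Perm (List.range (w.length + 1))
  permp : p.Perm (List.range' c (w.length + 1 - c))
  permq : q.Perm (List.range' c (w.length + 1 - c))
  lastp : ∃ p', p = p' ++ [w.length]
  lastq : ∃ q', q = q' ++ [w.length]
  nodup : ((treeEdges x₀ r ++ pathEdges p ++ pathEdges q).map norm).Nodup
  cover : ∀ e ∈ treeEdges x₀ r ++ pathEdges p ++ pathEdges q, ∃ s, (norm e, s) ∈ D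
  oneCross : OneCross D
  bound : ∀ e ∈ D, e.1.2 ≤ w.length
  head : lastHead x₀ r = v
  visible : ∀ e ∈ D, e.2 = side → ¬ (e.1.1 < v ∧ v < e.1.2)
  first : c = 0 ∨ c = 1 ∧ x₀ = 0

/-- The layout of a piece to be glued to the right of a partial packing. It is written with local
places: `0`, `1`, `2` stand for the place `0`, the head and the last place of the partial packing,
and `3, 4, …` are new places. The places `tree` hold the new vertices of the caterpillar in the
order in which they are attached; besides, the places `pend` form a path hanging from the place
`0`. The two paths continue from `2` along `p` and `q`. The edges in `bot` lie in the page opposite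
to the one in which the head is visible, all other new edges lie in that page. -/
structure Layout where
  tree : List ℕ
  pend : List ℕ
  p : List ℕ
  q : List ℕ
  bot : List (ℕ × ℕ)

/-- A layout together with the tags of the new vertices of the caterpillar. -/
structure Gadget extends Layout where
  tags : List Bool

namespace Gadget

/-- The number of new vertices. -/
def size (g : Gadget) : ℕ := g.tree.length + g.pend.length

/-- The new edges, where `h` is the local place of the head. -/
def edges (g : Gadget) (h : ℕ) : List (ℕ × ℕ) :=
  treeEdges h (g.tags.zip g.tree) ++ pathEdges (0 :: g.pend) ++ pathEdges (2 :: g.p) ++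
    pathEdges (2 :: g.q)

/-- The drawing of the new edges. -/
def draw (g : Gadget) (h : ℕ) : List ((ℕ × ℕ) × Bool) :=
  (g.edges h).map fun e => (norm e, !(g.bot.contains (norm e)))

instance (e f : (ℕ × ℕ) × Bool) : Decidable (Cross e f) := by unfold Cross; infer_instance

/-- The conditions under which gluing keeps the drawing valid: every new edge ends at a new place,
it lies in the page where the head is visible if it starts at the local place `1` of the head, and
it crosses at most one other new edge. -/
structure Valid (g : Gadget) (h : ℕ) : Prop where
  length : g.tags.length = g.tree.length
  perm : (g.tree ++ g.pend).Perm (List.range' 3 g.size)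
  nodup : ((g.edges h).map norm).Nodup
  bound : ∀ e ∈ g.draw h, e.1.1 < e.1.2 ∧ 3 ≤ e.1.2 ∧ (e.1.1 = 1 → e.2 = true)
  cross : ∀ e ∈ g.draw h, ((g.draw h).filter fun f => decide (Cross e f)).length ≤ 1

lemma Valid.oneCross {g : Gadget} {h : ℕ} (hg : g.Valid h) : OneCross (g.draw h) := by
  intro e he f hf k hk hef hek
  have h1 : f ∈ (g.draw h).filter fun f => decide (Cross e f) := by simp [hf, hef]
  have h2 : k ∈ (g.draw h).filter fun f => decide (Cross e f) := by simp [hk, hek]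
  have h3 := hg.cross e he
  revert h1 h2 h3
  generalize (g.draw h).filter (fun f => decide (Cross e f)) = l
  rcases l with _ | ⟨a, _ | ⟨b, l⟩⟩ <;> simp +contextual

end Gadget

/-- The global place of a local place, when the head is at `v` and the last place is `u`. -/
def glue (v u i : ℕ) : ℕ := if i = 0 then 0 else if i = 1 then v else u + (i - 2)

lemma glue_mono {v u : ℕ} (h : v ≤ u) : Monotone (glue v u) := by
  intro i j hij
  unfold glue
  split_ifs <;> omega

lemma glue_two (v u : ℕ) : glue v u 2 = u := rfl

lemma norm_map {f : ℕ → ℕ} (hf : Monotone f) (e : ℕ × ℕ) :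
    norm (Prod.map f f e) = Prod.map f f (norm e) := by
  simp [norm, hf.map_min, hf.map_max]

lemma lt_glue {v u i : ℕ} (hi : 3 ≤ i) : u < glue v u i := by
  unfold glue; split_ifs <;> omega

lemma map_glue_range' (v u k : ℕ) :
    (List.range' 3 k).map (glue v u) = List.range' (u + 1) k := by
  apply List.ext_getElem (by simp)
  intro i h1 h2
  simp only [List.getElem_map, List.getElem_range', glue]
  split_ifs <;> omega

lemma map_norm_pathEdges_reverse (l : List ℕ) :
    ((pathEdges l.reverse).map norm).Perm ((pathEdges l).map norm) := by
  induction l with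
  | nil => rfl
  | cons a l ih =>
    cases l with
    | nil => rfl
    | cons b l =>
      rw [List.reverse_cons, List.reverse_cons, List.append_assoc, List.singleton_append,
        pathEdges_append, ← List.reverse_cons]
      refine (List.Perm.of_eq (List.map_append)).trans ?_
      refine List.perm_append_comm.trans ?_
      rw [show ((pathEdges [b, a]).map norm) = [norm (a, b)] by simp [pathEdges, norm_swap b a]]
      exact ih.cons _

lemma treeEdges_map_true {α : Type*} (a : α) (l : List α) :
    treeEdges a (l.map (Prod.mk true)) = pathEdges (a :: l) := by
  induction l generalizing a with
  | nil => rfl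
  | cons b l ih => simp [treeEdges, pathEdges_cons_cons, ih]

lemma lastHead_map_true {α : Type*} (a : α) (l : List α) (b : α) :
    lastHead a ((l ++ [b]).map (Prod.mk true)) = b := by
  induction l generalizing a with
  | nil => rfl
  | cons c l ih => simpa [lastHead] using ih c

section Glue

variable {c : ℕ} {w : List Bool} {x₀ : ℕ} {r : List (Bool × ℕ)} {p q : List ℕ}
  {D : List ((ℕ × ℕ) × Bool)} {v : ℕ} {side : Bool}

lemma Partial.head_le (P : Partial c w x₀ r p q D v side) : v ≤ w.length := by
  have : ∀ (h : ℕ) (r : List (Bool × ℕ)), lastHead h r ∈ h :: r.map Prod.snd := by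
    intro h r
    induction r generalizing h with
    | nil => simp [lastHead]
    | cons a r ih =>
      obtain ⟨s, x⟩ := a
      cases s
      · rcases List.mem_cons.1 (ih h) with h1 | h1 <;> simp [lastHead, h1]
      · simpa [lastHead] using Or.inr (ih x)
  have := P.perm.mem_iff.1 (this x₀ r)
  rw [P.head, List.mem_range] at this
  omega

lemma Partial.edges_snd_le (P : Partial c w x₀ r p q D v side) :
    ∀ e ∈ (treeEdges x₀ r ++ pathEdges p ++ pathEdges q).map norm, e.2 ≤ w.length := by
  intro e he
  obtain ⟨e', he', rfl⟩ := List.mem_map.1 he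
  obtain ⟨s, hs⟩ := P.cover e' he'
  exact P.bound _ hs

/-- The drawing after gluing a gadget. -/
def glueDraw (D : List ((ℕ × ℕ) × Bool)) (v u : ℕ) (side : Bool) (g : Gadget) (h : ℕ) :
    List ((ℕ × ℕ) × Bool) :=
  D ++ (g.draw h).map fun e => (Prod.map (glue v u) (glue v u) e.1, e.2 == side)

/-- Old and new edges never cross: a new edge starts at the place `0`, at or to the right of the
last place, or at the head in the page where the head is visible. -/
lemma Partial.not_cross (P : Partial c w x₀ r p q D v side) {g : Gadget} {h : ℕ}
    (hg : g.Valid h) {e f : (ℕ × ℕ) × Bool} (he : e ∈ D) (hf : f ∈ g.draw h) :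
    ¬ Cross e (Prod.map (glue v w.length) (glue v w.length) f.1, f.2 == side) := by
  obtain ⟨⟨i, j⟩, s⟩ := f
  obtain ⟨⟨a, b⟩, t⟩ := e
  obtain ⟨hij, hj, hs⟩ := hg.bound _ hf
  have hb := P.bound _ he
  have hvis := P.visible _ he
  simp only at hij hj hs hb hvis
  rintro ⟨hpage, hc⟩
  have hj' := lt_glue (v := v) (u := w.length) hj
  simp only [Prod.map] at hpage hc
  rcases Nat.lt_or_ge i 2 with hi | hi
  · interval_cases i
    · simp only [glue, if_true] at hc hj'
      omega
    · have hs := hs rfl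
      subst hs
      have hg1 : glue v w.length 1 = v := rfl
      rw [hg1] at hc
      apply hvis (by simpa using hpage)
      omega
  · have := glue_mono P.head_le hi
    rw [glue_two] at this
    omega

lemma Partial.glueDraw_oneCross (P : Partial c w x₀ r p q D v side) {g : Gadget} {h : ℕ}
    (hg : g.Valid h) : OneCross (glueDraw D v w.length side g h) := by
  have hsymm : ∀ {e f}, Cross e f → Cross f e := fun h => ⟨h.1.symm, h.2.symm⟩
  -- a crossing after gluing is already a crossing of the local places, as `glue` is monotone
  have hback : ∀ e f : (ℕ × ℕ) × Bool,
      Cross (Prod.map (glue v w.length) (glue v w.length) e.1, e.2 == side)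
        (Prod.map (glue v w.length) (glue v w.length) f.1, f.2 == side) → Cross e f := by
    rintro ⟨⟨a, b⟩, s⟩ ⟨⟨a', b'⟩, s'⟩ ⟨h1, h2⟩
    have hm := fun i j => (glue_mono P.head_le).reflect_lt (a := i) (b := j)
    refine ⟨?_, h2.imp (fun h => ⟨hm _ _ h.1, hm _ _ h.2.1, hm _ _ h.2.2⟩)
      (fun h => ⟨hm _ _ h.1, hm _ _ h.2.1, hm _ _ h.2.2⟩)⟩
    revert h1
    cases s <;> cases s' <;> cases side <;> simp
  intro e he f hf k hk hef hek
  simp only [glueDraw, List.mem_append, List.mem_map] at he hf hk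
  rcases he with he | ⟨e, he, rfl⟩
  · rcases hf with hf | ⟨f, hf, rfl⟩
    · rcases hk with hk | ⟨k, hk, rfl⟩
      · exact P.oneCross e he f hf k hk hef hek
      · exact absurd hek (P.not_cross hg he hk)
    · exact absurd hef (P.not_cross hg he hf)
  · rcases hf with hf | ⟨f, hf, rfl⟩
    · exact absurd (hsymm hef) (P.not_cross hg hf he)
    · rcases hk with hk | ⟨k, hk, rfl⟩
      · exact absurd (hsymm hek) (P.not_cross hg hk he)
      · rw [hg.oneCross e he f hf k hk (hback _ _ hef) (hback _ _ hek)]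

lemma Partial.glue_cover (P : Partial c w x₀ r p q D v side) (g : Gadget) (h : ℕ) :
    ∀ e ∈ treeEdges x₀ r ++ pathEdges p ++ pathEdges q ++
      (g.edges h).map (Prod.map (glue v w.length) (glue v w.length)),
      ∃ s, (norm e, s) ∈ glueDraw D v w.length side g h := by
  intro e he
  rcases List.mem_append.1 he with he | he
  · obtain ⟨s, hs⟩ := P.cover e he
    exact ⟨s, List.mem_append_left _ hs⟩
  · obtain ⟨e', he', rfl⟩ := List.mem_map.1 he
    rw [norm_map (glue_mono P.head_le)]
    exact ⟨_, List.mem_append_right _ (List.mem_map.2 ⟨_, List.mem_map.2 ⟨e', he', rfl⟩, rfl⟩)⟩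

lemma Partial.glue_nodup (P : Partial c w x₀ r p q D v side) {g : Gadget} {h : ℕ}
    (hg : g.Valid h)
    (hinj : ∀ e ∈ (g.edges h).map norm, ∀ f ∈ (g.edges h).map norm, e.2 = f.2 →
      glue v w.length e.1 = glue v w.length f.1 → e.1 = f.1) :
    ((treeEdges x₀ r ++ pathEdges p ++ pathEdges q ++
      (g.edges h).map (Prod.map (glue v w.length) (glue v w.length))).map norm).Nodup := by
  have hb : ∀ e ∈ (g.edges h).map norm, 3 ≤ e.2 := by
    intro e he
    obtain ⟨e', he', rfl⟩ := List.mem_map.1 he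
    exact (hg.bound _ (List.mem_map.2 ⟨e', he', rfl⟩)).2.1
  have hmap : ((g.edges h).map (Prod.map (glue v w.length) (glue v w.length))).map norm =
      ((g.edges h).map norm).map (Prod.map (glue v w.length) (glue v w.length)) := by
    rw [List.map_map, List.map_map]
    exact List.map_congr_left fun e _ => norm_map (glue_mono P.head_le) e
  rw [List.map_append, hmap]
  refine List.nodup_append.2 ⟨P.nodup, ?_, ?_⟩
  · refine List.Nodup.map_on ?_ hg.nodup
    intro e he f hf hef
    have h1 := congrArg Prod.fst hef
    have h2 := congrArg Prod.snd hef
    simp only [Prod.map] at h1 h2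
    have he3 := hb e he
    have hf3 := hb f hf
    have h2' : e.2 = f.2 := by
      simp only [glue] at h2
      split_ifs at h2 <;> omega
    exact Prod.ext (hinj e he f hf h2' h1) h2'
  · intro e he f hf hef
    obtain ⟨f', hf', rfl⟩ := List.mem_map.1 hf
    have h1 := P.edges_snd_le e he
    have h2 := lt_glue (v := v) (u := w.length) (hb f' hf')
    rw [hef] at h1
    simp only [Prod.map] at h1
    omega

/-- The conditions under which gluing yields a partial packing again, whose head has the local
place `h'`. It is visible in the same page as the old head if `s` is true, and in the other page
otherwise. -/
structure Gadget.Extends (g : Gadget) (h h' : ℕ) (s : Bool) : Prop extends g.Valid h where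
  pend : g.pend = []
  permp : g.p.Perm (List.range' 3 g.size)
  permq : g.q.Perm (List.range' 3 g.size)
  lastp : g.p.getLast? = some (g.size + 2)
  lastq : g.q.getLast? = some (g.size + 2)
  head : lastHead h (g.tags.zip g.tree) = h'
  low : ∀ e ∈ g.draw h, h ≤ e.1.1
  high : ∀ e ∈ g.draw h, e.1.2 ≤ g.size + 2
  visible : ∀ e ∈ g.draw h, e.2 = s → ¬ (e.1.1 < h' ∧ h' < e.1.2)
  new : h' = h ∧ s = true ∨ 3 ≤ h'

lemma glue_inj_of_le {h v u i j : ℕ} (hh : h = 1 ∧ v < u ∨ h = 2) (hi : h ≤ i) (hj : h ≤ j)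
    (hij : glue v u i = glue v u j) : i = j := by
  simp only [glue] at hij
  rcases hh with ⟨rfl, hlt⟩ | rfl <;> split_ifs at hij <;> omega

lemma map_fst_zip_glue (g : Gadget) (hg : g.tags.length = g.tree.length) (f : ℕ → ℕ) :
    ((g.tags.zip g.tree).map (Prod.map id f)).map Prod.fst = g.tags := by
  rw [List.map_map]
  exact List.map_fst_zip hg.le

lemma map_snd_zip_glue (g : Gadget) (hg : g.tags.length = g.tree.length) (f : ℕ → ℕ) :
    ((g.tags.zip g.tree).map (Prod.map id f)).map Prod.snd = g.tree.map f := by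
  conv_rhs => rw [← List.map_snd_zip (l₁ := g.tags) hg.ge]
  simp [Function.comp_def]

lemma edges_glue (g : Gadget) (h v u : ℕ) (hv : glue v u h = v) :
    (g.edges h).map (Prod.map (glue v u) (glue v u)) =
      treeEdges v ((g.tags.zip g.tree).map (Prod.map id (glue v u))) ++
      pathEdges (0 :: g.pend.map (glue v u)) ++ pathEdges (u :: g.p.map (glue v u)) ++
      pathEdges (u :: g.q.map (glue v u)) := by
  have htree := treeEdges_map (glue v u) h (g.tags.zip g.tree)
  rw [hv] at htree
  rw [htree, show (0 :: g.pend.map (glue v u)) = (0 :: g.pend).map (glue v u) from rfl,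
    show (u :: g.p.map (glue v u)) = (2 :: g.p).map (glue v u) from rfl,
    show (u :: g.q.map (glue v u)) = (2 :: g.q).map (glue v u) from rfl,
    pathEdges_map, pathEdges_map, pathEdges_map, Gadget.edges]
  simp

lemma perm_range'_append {c n k : ℕ} (hc : c ≤ n) {l l' : List ℕ}
    (h : l.Perm (List.range' c (n - c))) (h' : l'.Perm (List.range' n k)) :
    (l ++ l').Perm (List.range' c (n + k - c)) := by
  have := h.append h'
  rw [show List.range' n k = List.range' (c + 1 * (n - c)) k by congr 1; omega,
    List.range'_append] at this
  rwa [show n + k - c = n - c + k by omega]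

/-- Gluing a gadget to a partial packing. The head has the local place `h`, which is `1` in general
and `2` if the head is the last place; the local places `1` and `2` coincide then. -/
lemma Partial.extend (P : Partial c w x₀ r p q D v side) {g : Gadget} {h h' : ℕ} {s : Bool}
    (hg : g.Extends h h' s) (hh : h = 1 ∧ v < w.length ∨ h = 2 ∧ v = w.length) :
    Partial c (w ++ g.tags) x₀
      (r ++ (g.tags.zip g.tree).map (Prod.map id (glue v w.length)))
      (p ++ g.p.map (glue v w.length)) (q ++ g.q.map (glue v w.length))
      (glueDraw D v w.length side g h) (glue v w.length h') (s == side) := by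
  have hv : glue v w.length h = v := by rcases hh with ⟨rfl, -⟩ | ⟨rfl, rfl⟩ <;> rfl
  have hle := P.head_le
  have hsize : g.size = g.tags.length := by simp [Gadget.size, hg.pend, hg.length]
  have hc : c ≤ w.length + 1 := by rcases P.first with rfl | ⟨rfl, -⟩ <;> omega
  have hlen : (w ++ g.tags).length + 1 = w.length + 1 + g.size := by simp [hsize]; omega
  have hperm : ∀ l : List ℕ, l.Perm (List.range' 3 g.size) →
      (l.map (glue v w.length)).Perm (List.range' (w.length + 1) g.size) := fun l hl => by
    rw [← map_glue_range' v]; exact hl.map _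
  have hlast : ∀ l : List ℕ, l.getLast? = some (g.size + 2) → ∀ l₀ : List ℕ,
      ∃ l', l₀ ++ l.map (glue v w.length) = l' ++ [(w ++ g.tags).length] := by
    intro l hl l₀
    obtain ⟨l', rfl⟩ := List.getLast?_eq_some_iff.1 hl
    refine ⟨l₀ ++ l'.map (glue v w.length), ?_⟩
    simp [glue, hsize]
  obtain ⟨p', hp'⟩ := P.lastp
  obtain ⟨q', hq'⟩ := P.lastq
  have hpath : ∀ l l' : List ℕ, l = l' ++ [w.length] → ∀ m : List ℕ,
      pathEdges (l ++ m) = pathEdges l ++ pathEdges (w.length :: m) := by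
    rintro l l' rfl m
    rw [List.append_assoc, List.singleton_append, pathEdges_append]
  have hE : (treeEdges x₀ (r ++ (g.tags.zip g.tree).map (Prod.map id (glue v w.length))) ++
      pathEdges (p ++ g.p.map (glue v w.length)) ++
      pathEdges (q ++ g.q.map (glue v w.length))).Perm
      (treeEdges x₀ r ++ pathEdges p ++ pathEdges q ++
      (g.edges h).map (Prod.map (glue v w.length) (glue v w.length))) := by
    rw [edges_glue g h v _ hv, treeEdges_append, P.head, hpath p p' hp', hpath q q' hq', hg.pend]
    rw [← Multiset.coe_eq_coe]
    simp only [← Multiset.coe_add, List.map_nil, show pathEdges [0] = [] from rfl,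
      Multiset.coe_nil, add_zero]
    abel
  have hnew : ∀ e ∈ (g.edges h).map norm, h ≤ e.1 := by
    intro e he
    obtain ⟨e', he', rfl⟩ := List.mem_map.1 he
    exact hg.low _ (List.mem_map.2 ⟨e', he', rfl⟩)
  refine
    { tags := by rw [List.map_append, P.tags, map_fst_zip_glue g hg.length]
      perm := ?_
      permp := by
        rw [hlen]
        exact perm_range'_append hc P.permp (hperm _ hg.permp)
      permq := by
        rw [hlen]
        exact perm_range'_append hc P.permq (hperm _ hg.permq)
      lastp := hlast _ hg.lastp _
      lastq := hlast _ hg.lastq _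
      nodup := by
        rw [(hE.map norm).nodup_iff]
        refine P.glue_nodup hg.toValid ?_
        intro e he f hf _ hef
        have h1 := hnew e he
        have h2 := hnew f hf
        exact glue_inj_of_le (hh.imp_right And.left) h1 h2 hef
      cover := fun e he => P.glue_cover g h e (hE.mem_iff.1 he)
      oneCross := P.glueDraw_oneCross hg.toValid
      bound := ?_
      head := ?_
      visible := ?_
      first := P.first }
  · rw [hlen, List.map_append, ← List.cons_append]
    rw [map_snd_zip_glue g hg.length]
    have h3 := hg.perm
    rw [hg.pend, List.append_nil] at h3
    have := perm_range'_append (Nat.zero_le _)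
      (by simpa [List.range_eq_range'] using P.perm) (hperm _ h3)
    simpa [List.range_eq_range'] using this
  · intro e he
    rcases List.mem_append.1 he with he' | he'
    · have := P.bound e he'
      simp; omega
    · obtain ⟨e, he₁, rfl⟩ := List.mem_map.1 he'
      have h2 := (hg.toValid.bound e he₁).2.1
      have h3 := hg.high e he₁
      obtain ⟨⟨a, b⟩, t⟩ := e
      simp only [Prod.map, List.length_append, ← hsize, glue] at h2 h3 ⊢
      split_ifs <;> omega
  · rw [lastHead_append, P.head]
    have := lastHead_map (glue v w.length) h (g.tags.zip g.tree)
    rwa [hv, hg.head] at this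
  · intro e he hs
    rcases List.mem_append.1 he with he' | he'
    · have hb := P.bound _ he'
      rcases hg.new with ⟨rfl, rfl⟩ | hn
      · rw [hv]
        exact P.visible e he' (by simpa using hs)
      · have := lt_glue (v := v) (u := w.length) hn
        omega
    · obtain ⟨e, he₁, rfl⟩ := List.mem_map.1 he'
      have hm := fun i j => (glue_mono hle).reflect_lt (a := i) (b := j)
      rintro ⟨h1, h2⟩
      refine hg.visible e he₁ ?_ ⟨hm _ _ h1, hm _ _ h2⟩
      revert hs
      obtain ⟨_, e2⟩ := e
      cases e2 <;> cases s <;> cases side <;> simp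

/-- The conditions under which gluing completes the packing. For `c = 1` the paths run through
the place `0` now; if the head and the place `0` may coincide (`d = true`), no new vertex is
joined to both. -/
structure Gadget.Completes (g : Gadget) (c : ℕ) (h : ℕ) (d : Bool) : Prop
    extends g.Valid h where
  pend : g.pend = [] ∨ c = 1
  permp : g.p.Perm (List.range c ++ List.range' 3 g.size)
  permq : g.q.Perm (List.range c ++ List.range' 3 g.size)
  low : h = 2 → ∀ e ∈ g.draw h, 2 ≤ e.1.1
  sep : d = true → ∀ e ∈ (g.edges h).map norm, e.1 = 0 → (1, e.2) ∉ (g.edges h).map norm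

/-- Gluing a gadget that completes the packing. The path hanging from the place `0`, read from its
far end, becomes the beginning of the caterpillar. -/
lemma Partial.complete (P : Partial c w x₀ r p q D v side) {g : Gadget} {h : ℕ} {d : Bool}
    (hg : g.Completes c h d) (hh : h = 1 ∧ v < w.length ∨ h = 2 ∧ v = w.length)
    (hd : d = true ∨ v ≠ 0) :
    Realizable (List.replicate g.pend.length true ++ (w ++ g.tags)) := by
  have hv : glue v w.length h = v := by rcases hh with ⟨rfl, -⟩ | ⟨rfl, rfl⟩ <;> rfl
  set φ := glue v w.length with hφ
  have hφ0 : φ 0 = 0 := rfl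
  have hlen : (List.replicate g.pend.length true ++ (w ++ g.tags)).length + 1 =
      w.length + 1 + g.size := by
    simp [Gadget.size, hg.length]; omega
  obtain ⟨p', hp'⟩ := P.lastp
  obtain ⟨q', hq'⟩ := P.lastq
  have hpath : ∀ l l' : List ℕ, l = l' ++ [w.length] → ∀ m : List ℕ,
      pathEdges (l ++ m) = pathEdges l ++ pathEdges (w.length :: m) := by
    rintro l l' rfl m
    rw [List.append_assoc, List.singleton_append, pathEdges_append]
  have hcle : c ≤ 1 := by rcases P.first with rfl | ⟨rfl, -⟩ <;> omega
  have hperm : ∀ l l₀ : List ℕ, l.Perm (List.range c ++ List.range' 3 g.size) →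
      l₀.Perm (List.range' c (w.length + 1 - c)) →
      (l₀ ++ l.map φ).Perm (List.range (w.length + 1 + g.size)) := by
    intro l l₀ hl hl₀
    have h1 := hl.map φ
    rw [List.map_append, map_glue_range',
      show (List.range c).map φ = List.range c by
        obtain rfl | rfl : c = 0 ∨ c = 1 := by omega
        · rfl
        · simp [hφ0]] at h1
    have h2 : (List.range (w.length + 1 + g.size)) =
        List.range c ++ (List.range' c (w.length + 1 - c) ++
          List.range' (w.length + 1) g.size) := by
      rw [List.range_eq_range', List.range_eq_range',
        show List.range' (w.length + 1) g.size =
          List.range' (c + 1 * (w.length + 1 - c)) g.size by congr 1; omega,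
        List.range'_append]
      conv_rhs => enter [2, 1]; rw [show c = 0 + 1 * c by omega]
      rw [List.range'_append]
      congr 1; omega
    rw [h2]
    refine (hl₀.append h1).trans ?_
    rw [← List.append_assoc, ← List.append_assoc]
    exact List.perm_append_comm.append_right _
  -- the hanging path, from its far end to the first vertex
  obtain ⟨x, l, hxl⟩ : ∃ x l, (g.pend.map φ).reverse ++ [x₀] = x :: l :=
    List.exists_cons_of_ne_nil (by simp)
  have hl : l.length = g.pend.length := by simpa using (congrArg List.length hxl).symm
  set r₁ := r ++ (g.tags.zip g.tree).map (Prod.map id φ) with hr₁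
  have htree : treeEdges x (l.map (Prod.mk true) ++ r₁) =
      pathEdges ((g.pend.map φ).reverse ++ [x₀]) ++ treeEdges x₀ r₁ := by
    rw [treeEdges_append, treeEdges_map_true, hxl]
    congr 2
    rcases List.eq_nil_or_concat l with rfl | ⟨l', b, rfl⟩
    · have : g.pend = [] := List.eq_nil_of_length_eq_zero (by simpa using hl.symm)
      simp [this] at hxl
      exact hxl.symm
    · rw [List.concat_eq_append, lastHead_map_true]
      have := congrArg List.getLast? hxl
      simp at this
      rw [List.getLast?_cons] at this
      simpa using this.symm
  have hx₀ : ((pathEdges ((g.pend.map φ).reverse ++ [x₀])).map norm).Perm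
      ((pathEdges (0 :: g.pend.map φ)).map norm) := by
    rcases hg.pend with hp | hc
    · simp [hp, pathEdges]
    · have : x₀ = 0 := by rcases P.first with h | h <;> omega
      subst this
      rw [← List.reverse_cons]
      exact map_norm_pathEdges_reverse _
  have hE : ((treeEdges x (l.map (Prod.mk true) ++ r₁) ++ pathEdges (p ++ g.p.map φ) ++
      pathEdges (q ++ g.q.map φ)).map norm).Perm
      ((treeEdges x₀ r ++ pathEdges p ++ pathEdges q ++
      (g.edges h).map (Prod.map φ φ)).map norm) := by
    rw [edges_glue g h v _ hv, htree, hr₁, treeEdges_append, P.head, hpath p p' hp',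
      hpath q q' hq']
    rw [← Multiset.coe_eq_coe]
    rw [← Multiset.coe_eq_coe] at hx₀
    simp only [List.map_append, ← Multiset.coe_add]
    rw [hx₀]
    abel
  have hlow : ∀ e ∈ (g.edges h).map norm, h = 2 → 2 ≤ e.1 := by
    intro e he hh
    obtain ⟨e', he', rfl⟩ := List.mem_map.1 he
    exact hg.low hh _ (List.mem_map.2 ⟨e', he', rfl⟩)
  refine ⟨x, l.map (Prod.mk true) ++ r₁, p ++ g.p.map φ, q ++ g.q.map φ,
    glueDraw D v w.length side g h, ?_, ?_, ?_, ?_, ?_, ?_, P.glueDraw_oneCross hg.toValid⟩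
  · have : (l.map (Prod.mk true)).map Prod.fst = List.replicate g.pend.length true := by
      rw [List.map_map, ← hl, ← List.map_const']
      rfl
    rw [List.map_append, this, hr₁, List.map_append, P.tags, map_fst_zip_glue g hg.length]
  · rw [hlen, List.map_append, ← List.cons_append]
    have h0 : (l.map (Prod.mk true)).map Prod.snd = l := by simp [Function.comp_def]
    rw [h0, ← hxl, hr₁, List.map_append, map_snd_zip_glue g hg.length]
    have h3 := hg.perm.map φ
    rw [map_glue_range', List.map_append] at h3
    have h4 := perm_range'_append (Nat.zero_le _)
      (by simpa [List.range_eq_range'] using P.perm) h3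
    rw [List.range_eq_range']
    refine List.Perm.trans ?_ (by simpa using h4)
    rw [← Multiset.coe_eq_coe]
    simp only [← Multiset.coe_add, ← Multiset.cons_coe, Multiset.coe_reverse]
    rw [Multiset.coe_nil, ← Multiset.singleton_add, ← Multiset.singleton_add]
    abel
  · rw [hlen]; exact hperm _ _ hg.permp P.permp
  · rw [hlen]; exact hperm _ _ hg.permq P.permq
  · rw [hE.nodup_iff]
    refine P.glue_nodup hg.toValid ?_
    intro e he f hf h2 hef
    have h1 := hlow e he
    have h2' := hlow f hf
    have k1 : e.1 = 0 → f.1 = 1 → d = true → False := fun a b c =>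
      hg.sep c e he a (by rw [h2, ← b]; exact hf)
    have k2 : f.1 = 0 → e.1 = 1 → d = true → False := fun a b c =>
      hg.sep c f hf a (by rw [← h2, ← b]; exact he)
    simp only [glue] at hef
    rcases hh with ⟨rfl, hlt⟩ | ⟨rfl, rfl⟩
    · split_ifs at hef <;> first
        | omega
        | (rcases hd with hd | hd
           · exact (k1 ‹_› ‹_› hd).elim
           · omega)
        | (rcases hd with hd | hd
           · exact (k2 ‹_› ‹_› hd).elim
           · omega)
    · have := h1 rfl
      have := h2' rfl
      split_ifs at hef <;> omega
  · intro e he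
    have : norm e ∈ (treeEdges x₀ r ++ pathEdges p ++ pathEdges q ++
        (g.edges h).map (Prod.map φ φ)).map norm := hE.mem_iff.1 (List.mem_map_of_mem he)
    obtain ⟨e', he', hee⟩ := List.mem_map.1 this
    rw [← hee]
    exact P.glue_cover g h e' he'

end Glue

/-! ### The gadgets -/

-- The layouts below were found by a search; all that is used of them is that they satisfy
-- `Extends` or `Completes`, which is decided by evaluation.

namespace Gadget

instance (g : Gadget) (h : ℕ) : Decidable (g.Valid h) :=
  decidable_of_iff (g.tags.length = g.tree.length ∧
      (g.tree ++ g.pend).Perm (List.range' 3 g.size) ∧ ((g.edges h).map norm).Nodup ∧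
      (∀ e ∈ g.draw h, e.1.1 < e.1.2 ∧ 3 ≤ e.1.2 ∧ (e.1.1 = 1 → e.2 = true)) ∧
      ∀ e ∈ g.draw h, ((g.draw h).filter fun f => decide (Cross e f)).length ≤ 1)
    ⟨fun ⟨h1, h2, h3, h4, h5⟩ => ⟨h1, h2, h3, h4, h5⟩,
      fun ⟨h1, h2, h3, h4, h5⟩ => ⟨h1, h2, h3, h4, h5⟩⟩

instance (g : Gadget) (h h' : ℕ) (s : Bool) : Decidable (g.Extends h h' s) :=
  decidable_of_iff (g.Valid h ∧ g.pend = [] ∧ g.p.Perm (List.range' 3 g.size) ∧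
      g.q.Perm (List.range' 3 g.size) ∧ g.p.getLast? = some (g.size + 2) ∧
      g.q.getLast? = some (g.size + 2) ∧ lastHead h (g.tags.zip g.tree) = h' ∧
      (∀ e ∈ g.draw h, h ≤ e.1.1) ∧ (∀ e ∈ g.draw h, e.1.2 ≤ g.size + 2) ∧
      (∀ e ∈ g.draw h, e.2 = s → ¬ (e.1.1 < h' ∧ h' < e.1.2)) ∧ (h' = h ∧ s = true ∨ 3 ≤ h'))
    ⟨fun ⟨h1, h2, h3, h4, h5, h6, h7, h8, h9, h10, h11⟩ =>
      ⟨h1, h2, h3, h4, h5, h6, h7, h8, h9, h10, h11⟩,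
      fun ⟨h1, h2, h3, h4, h5, h6, h7, h8, h9, h10, h11⟩ =>
      ⟨h1, h2, h3, h4, h5, h6, h7, h8, h9, h10, h11⟩⟩

instance (g : Gadget) (c h : ℕ) (d : Bool) : Decidable (g.Completes c h d) :=
  decidable_of_iff (g.Valid h ∧ (g.pend = [] ∨ c = 1) ∧
      g.p.Perm (List.range c ++ List.range' 3 g.size) ∧
      g.q.Perm (List.range c ++ List.range' 3 g.size) ∧
      (h = 2 → ∀ e ∈ g.draw h, 2 ≤ e.1.1) ∧
      (d = true → ∀ e ∈ (g.edges h).map norm, e.1 = 0 → (1, e.2) ∉ (g.edges h).map norm))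
    ⟨fun ⟨h1, h2, h3, h4, h5, h6⟩ => ⟨h1, h2, h3, h4, h5, h6⟩,
      fun ⟨h1, h2, h3, h4, h5, h6⟩ => ⟨h1, h2, h3, h4, h5, h6⟩⟩

end Gadget

/-- For `k`: `k` leaves at the head, or `k - 1` leaves and the next spine vertex. -/
def legLayout : ℕ → Layout
  | 5 => ⟨[3, 4, 5, 6, 7], [], [3, 4, 6, 5, 7], [4, 5, 3, 6, 7], [(3, 5), (3, 6), (5, 7)]⟩
  | 6 => ⟨[3, 4, 5, 6, 7, 8], [], [3, 4, 7, 5, 6, 8], [7, 6, 4, 5, 3, 8], [(2, 7), (3, 8), (4, 6),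
    (4, 7), (5, 7)]⟩
  | 7 => ⟨[3, 4, 5, 6, 7, 8, 9], [], [4, 8, 7, 6, 5, 3, 9], [3, 4, 6, 8, 5, 7, 9], [(2, 4),
    (3, 9), (4, 6), (4, 8), (5, 8), (6, 8)]⟩
  | 8 => ⟨[3, 4, 5, 6, 7, 8, 9, 10], [], [9, 7, 8, 6, 5, 4, 3, 10], [3, 5, 7, 6, 4, 8, 9, 10],
    [(2, 9), (3, 5), (3, 10), (4, 8), (5, 7), (6, 8)]⟩
  | 9 => ⟨[3, 4, 5, 6, 7, 8, 9, 10, 11], [], [3, 4, 5, 6, 7, 9, 8, 10, 11], [4, 6, 8, 7, 5, 9, 10,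
    3, 11], [(3, 10), (3, 11), (4, 6), (5, 9), (6, 8), (7, 9)]⟩
  | _ => ⟨[], [], [], [], []⟩

/-- For `r` and `j`: `j` leaves at the head, then `r` spine vertices of degree two, then a new
head with a first leaf. -/
def turnLayout : ℕ → ℕ → Layout
  | 0, 3 => ⟨[4, 5, 6, 3, 7], [], [3, 4, 6, 5, 7], [4, 5, 3, 6, 7], [(3, 5), (3, 6), (3, 7),
    (4, 6)]⟩
  | 0, 4 => ⟨[4, 5, 6, 7, 3, 8], [], [4, 3, 7, 5, 6, 8], [3, 5, 4, 6, 7, 8], [(3, 5), (3, 7),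
    (3, 8), (5, 7)]⟩
  | 0, 5 => ⟨[4, 5, 6, 7, 8, 3, 9], [], [4, 3, 5, 6, 7, 8, 9], [3, 8, 6, 4, 5, 7, 9], [(3, 5),
    (3, 8), (3, 9), (5, 7), (6, 8)]⟩
  | 0, 6 => ⟨[4, 5, 6, 7, 8, 9, 3, 10], [], [4, 3, 5, 6, 8, 7, 9, 10], [3, 7, 6, 4, 5, 9, 8, 10],
    [(3, 5), (3, 7), (3, 10), (5, 9), (7, 9)]⟩
  | 0, 7 => ⟨[4, 5, 6, 7, 8, 9, 10, 3, 11], [], [4, 5, 6, 7, 8, 3, 10, 9, 11], [3, 4, 6, 8, 9, 7,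
    5, 10, 11], [(3, 8), (3, 10), (3, 11), (5, 7), (5, 10), (6, 8)]⟩
  | 1, 3 => ⟨[3, 4, 6, 5, 7, 8], [], [3, 5, 4, 7, 6, 8], [7, 3, 4, 6, 5, 8], [(2, 7), (3, 7),
    (4, 6), (4, 7), (5, 7)]⟩
  | 1, 4 => ⟨[3, 5, 6, 7, 4, 8, 9], [], [3, 8, 6, 4, 5, 7, 9], [4, 3, 5, 8, 7, 6, 9], [(3, 5),
    (3, 8), (4, 8), (5, 7), (5, 8), (6, 8)]⟩
  | 1, 5 => ⟨[3, 4, 7, 8, 9, 6, 5, 10], [], [4, 3, 6, 7, 5, 9, 8, 10], [3, 5, 4, 6, 8, 7, 9, 10],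
    [(2, 4), (3, 5), (5, 7), (5, 9), (5, 10), (6, 8), (8, 10)]⟩
  | 1, 6 => ⟨[3, 4, 7, 8, 9, 10, 6, 5, 11], [], [4, 5, 3, 6, 7, 8, 9, 10, 11], [3, 4, 6, 8, 10, 5,
    7, 9, 11], [(2, 4), (3, 5), (5, 7), (5, 10), (5, 11), (7, 9), (8, 10)]⟩
  | 1, 7 => ⟨[3, 4, 7, 8, 9, 10, 11, 6, 5, 12], [], [4, 3, 6, 8, 9, 5, 7, 11, 10, 12], [3, 5, 4,
    6, 7, 8, 10, 9, 11, 12], [(2, 4), (3, 5), (5, 7), (5, 9), (5, 12), (7, 11), (9, 11)]⟩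
  | 2, 3 => ⟨[3, 7, 8, 6, 5, 4, 9], [], [3, 4, 8, 6, 7, 5, 9], [4, 6, 3, 5, 8, 7, 9], [(2, 4),
    (4, 8), (4, 9), (5, 7), (5, 8), (5, 9), (6, 8)]⟩
  | 2, 4 => ⟨[3, 4, 5, 6, 7, 8, 9, 10], [], [9, 3, 4, 6, 8, 5, 7, 10], [3, 5, 6, 7, 9, 4, 8, 10],
    [(2, 9), (3, 9), (4, 6), (4, 8), (4, 9), (5, 8), (6, 8)]⟩
  | 2, 5 => ⟨[3, 4, 7, 8, 9, 10, 6, 5, 11], [], [3, 4, 6, 7, 5, 10, 8, 9, 11], [4, 5, 3, 6, 8, 7,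
    9, 10, 11], [(2, 4), (3, 5), (5, 7), (5, 10), (5, 11), (6, 10), (7, 9), (8, 10)]⟩
  | 2, 6 => ⟨[4, 5, 6, 8, 9, 11, 10, 7, 3, 12], [], [4, 6, 5, 7, 8, 9, 10, 3, 11, 12], [5, 8, 6,
    7, 4, 3, 9, 11, 10, 12], [(3, 7), (3, 9), (3, 10), (3, 11), (3, 12), (4, 6), (4, 7), (5, 7),
    (7, 10), (10, 12)]⟩
  | 2, 7 => ⟨[4, 5, 8, 9, 10, 11, 12, 3, 6, 7, 13], [], [4, 6, 5, 3, 7, 8, 9, 10, 11, 12, 13], [3,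
    4, 5, 7, 10, 12, 8, 6, 9, 11, 13], [(3, 5), (3, 6), (3, 7), (5, 7), (7, 10), (7, 13), (8, 12),
    (10, 12)]⟩
  | 3, 3 => ⟨[6, 7, 9, 8, 5, 4, 3, 10], [], [5, 3, 6, 7, 8, 4, 9, 10], [3, 9, 8, 6, 5, 7, 4, 10],
    [(3, 9), (3, 10), (4, 7), (4, 8), (4, 9), (4, 10), (5, 7), (5, 8)]⟩
  | 3, 4 => ⟨[3, 4, 5, 10, 9, 6, 7, 8, 11], [], [7, 4, 3, 5, 6, 8, 9, 10, 11], [8, 10, 5, 4, 6, 3,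
    7, 9, 11], [(2, 7), (2, 8), (3, 6), (3, 7), (4, 6), (4, 7), (8, 10), (8, 11), (9, 11)]⟩
  | 3, 5 => ⟨[3, 4, 5, 7, 11, 6, 9, 8, 10, 12], [], [10, 9, 7, 5, 3, 4, 6, 8, 11, 12], [3, 10, 11,
    9, 4, 5, 6, 7, 8, 12], [(2, 10), (3, 10), (4, 6), (4, 9), (6, 8), (6, 9), (7, 9), (10, 12)]⟩
  | 3, 6 => ⟨[3, 4, 5, 9, 10, 11, 6, 7, 8, 12, 13], [], [8, 9, 5, 6, 3, 4, 7, 12, 10, 11, 13],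
    [12, 11, 8, 6, 4, 5, 3, 7, 9, 10, 13], [(2, 8), (2, 12), (3, 6), (3, 7), (4, 6), (4, 7),
    (7, 12), (8, 11), (8, 12), (10, 12)]⟩
  | 3, 7 => ⟨[3, 5, 6, 10, 11, 12, 13, 4, 8, 7, 9, 14], [], [4, 5, 6, 8, 3, 9, 10, 7, 11, 13, 12,
    14], [3, 4, 6, 7, 5, 8, 10, 12, 11, 9, 13, 14], [(3, 8), (3, 9), (4, 6), (4, 8), (5, 8),
    (6, 8), (9, 11), (9, 13), (9, 14), (10, 12), (12, 14)]⟩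
  | 4, 2 => ⟨[4, 9, 3, 6, 8, 5, 7, 10], [], [6, 7, 3, 5, 4, 8, 9, 10], [3, 4, 6, 5, 9, 7, 8, 10],
    [(2, 6), (3, 5), (3, 6), (3, 7), (4, 6), (7, 9), (7, 10), (8, 10)]⟩
  | 4, 4 => ⟨[3, 4, 9, 10, 5, 7, 8, 6, 11, 12], [], [4, 3, 6, 5, 8, 11, 7, 10, 9, 12], [11, 3, 7,
    6, 4, 5, 9, 8, 10, 12], [(2, 11), (3, 6), (3, 7), (3, 11), (4, 6), (6, 11), (7, 10), (7, 11),
    (8, 10), (8, 11)]⟩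
  | 4, 5 => ⟨[3, 4, 5, 6, 7, 12, 8, 9, 10, 11, 13], [], [3, 10, 4, 9, 5, 6, 8, 11, 12, 7, 13],
    [10, 5, 8, 7, 6, 4, 3, 11, 9, 12, 13], [(2, 10), (3, 10), (3, 11), (4, 9), (4, 10), (5, 8),
    (5, 9), (5, 10), (6, 8), (11, 13)]⟩
  | 4, 6 => ⟨[3, 4, 5, 6, 7, 13, 12, 11, 9, 8, 10, 14], [], [9, 10, 13, 11, 8, 5, 3, 4, 6, 7, 12,
    14], [4, 5, 9, 3, 10, 11, 7, 8, 6, 12, 13, 14], [(2, 9), (3, 5), (3, 9), (3, 10), (5, 8),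
    (5, 9), (6, 8), (10, 13), (10, 14), (11, 13)]⟩
  | 5, 1 => ⟨[4, 9, 5, 8, 6, 3, 7, 10], [], [3, 5, 7, 6, 4, 8, 9, 10], [6, 5, 4, 3, 9, 7, 8, 10],
    [(2, 6), (3, 5), (3, 6), (3, 7), (4, 6), (7, 9), (7, 10), (8, 10)]⟩
  | 5, 4 => ⟨[4, 5, 8, 9, 6, 3, 7, 11, 10, 12, 13], [], [12, 3, 4, 5, 6, 7, 10, 8, 9, 11, 13], [4,
    6, 8, 5, 3, 11, 12, 7, 9, 10, 13], [(2, 12), (3, 5), (3, 6), (3, 7), (3, 11), (3, 12), (4, 6),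
    (7, 9), (7, 10), (7, 11), (7, 12), (9, 11)]⟩
  | 5, 5 => ⟨[3, 4, 5, 9, 10, 8, 6, 11, 7, 12, 13, 14], [], [4, 3, 13, 11, 12, 6, 5, 7, 8, 10, 9,
    14], [3, 5, 9, 8, 11, 10, 7, 6, 13, 4, 12, 14], [(2, 4), (3, 13), (4, 12), (4, 13), (6, 11),
    (6, 12), (6, 13), (7, 10), (7, 11), (7, 12), (8, 10), (8, 11)]⟩
  | 6, 0 => ⟨[4, 9, 8, 6, 5, 3, 7, 10], [], [3, 9, 7, 6, 4, 5, 8, 10], [6, 3, 4, 8, 7, 5, 9, 10],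
    [(2, 6), (3, 5), (3, 6), (3, 7), (4, 6), (7, 9), (7, 10), (8, 10)]⟩
  | 6, 4 => ⟨[6, 7, 8, 13, 10, 9, 5, 4, 11, 12, 3, 14], [], [4, 9, 8, 7, 6, 5, 11, 3, 13, 10, 12,
    14], [3, 6, 4, 12, 13, 11, 9, 7, 5, 8, 10, 14], [(3, 11), (3, 12), (3, 13), (3, 14), (4, 9),
    (4, 11), (4, 12), (5, 7), (5, 8), (5, 9), (5, 11), (7, 9), (9, 11), (12, 14)]⟩
  | _, _ => ⟨[], [], [], [], []⟩

/-- For `t`: a run of `t` spine vertices, the last one being a new head, and a first leaf of it. -/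
def runLayout : ℕ → Layout
  | 7 => ⟨[6, 5, 8, 7, 9, 4, 3, 10], [], [8, 9, 5, 3, 7, 6, 4, 10], [7, 5, 4, 8, 6, 3, 9, 10],
    [(2, 6), (2, 7), (2, 8), (3, 5), (3, 6), (3, 7), (4, 6), (7, 9)]⟩
  | 8 => ⟨[6, 5, 7, 9, 8, 10, 4, 3, 11], [], [3, 9, 10, 7, 8, 5, 4, 6, 11], [7, 6, 8, 4, 9, 5, 3,
    10, 11], [(2, 6), (2, 7), (3, 5), (4, 6), (6, 11), (7, 9), (7, 10), (8, 10)]⟩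
  | 9 => ⟨[11, 7, 5, 8, 10, 3, 9, 4, 6, 12], [], [5, 4, 8, 6, 7, 9, 10, 11, 3, 12], [3, 4, 10, 7,
    8, 9, 5, 6, 11, 12], [(2, 11), (3, 9), (3, 10), (3, 11), (3, 12), (4, 8), (4, 9), (4, 10),
    (5, 7), (5, 8), (5, 9), (6, 8)]⟩
  | 10 => ⟨[10, 8, 7, 9, 11, 6, 12, 5, 4, 3, 13], [], [9, 10, 6, 5, 7, 4, 8, 3, 12, 11, 13], [8,
    9, 3, 5, 11, 10, 7, 6, 4, 12, 13], [(2, 8), (2, 9), (2, 10), (3, 8), (3, 9), (4, 6), (4, 7),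
    (4, 8), (5, 7), (9, 11), (11, 13)]⟩
  | 11 => ⟨[10, 11, 7, 9, 4, 6, 8, 12, 5, 13, 3, 14], [], [4, 3, 12, 7, 5, 6, 9, 8, 10, 13, 11,
    14], [3, 5, 4, 10, 9, 11, 8, 7, 6, 12, 13, 14], [(2, 4), (2, 10), (4, 6), (4, 9), (4, 10),
    (6, 8), (6, 9), (7, 9), (10, 13), (11, 13), (11, 14)]⟩
  | 12 => ⟨[11, 10, 6, 13, 4, 12, 7, 8, 3, 5, 9, 14, 15], [], [14, 11, 13, 12, 10, 9, 8, 6, 7, 5,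
    4, 3, 15], [3, 13, 14, 12, 11, 9, 7, 10, 8, 5, 6, 4, 15], [(3, 13), (3, 15), (4, 6), (4, 12),
    (4, 13), (4, 15), (6, 10), (6, 13), (7, 9), (7, 10), (7, 12), (8, 10), (10, 12)]⟩
  | 13 => ⟨[14, 15, 3, 4, 6, 7, 10, 11, 9, 8, 13, 12, 5, 16], [], [4, 14, 9, 10, 6, 5, 3, 8, 7,
    11, 13, 15, 12, 16], [3, 14, 12, 11, 6, 8, 10, 13, 9, 7, 4, 5, 15, 16], [(2, 14), (3, 8),
    (3, 14), (3, 15), (4, 6), (4, 7), (4, 14), (6, 8), (8, 13), (9, 11), (9, 13), (9, 14),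
    (10, 13), (11, 13)]⟩
  | 14 => ⟨[16, 4, 3, 14, 6, 7, 5, 13, 11, 8, 9, 10, 12, 15, 17], [], [4, 5, 12, 7, 8, 6, 10, 11,
    9, 13, 14, 15, 16, 3, 17], [3, 15, 5, 6, 9, 7, 11, 12, 8, 10, 13, 4, 14, 16, 17], [(2, 16),
    (3, 14), (3, 16), (3, 17), (4, 13), (4, 14), (4, 16), (6, 8), (6, 9), (6, 10), (6, 14),
    (7, 9), (9, 13), (10, 12), (10, 13), (11, 13), (14, 16)]⟩
  | _ => ⟨[], [], [], [], []⟩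

/-- For `t`: `t - 1` spine vertices and a last leaf, which end the caterpillar. -/
def tailLayout : ℕ → Layout
  | 6 => ⟨[3, 6, 8, 5, 7, 4], [], [8, 4, 5, 3, 7, 6], [7, 8, 3, 4, 6, 5], [(3, 5), (4, 8), (5, 7),
    (5, 8), (6, 8)]⟩
  | 7 => ⟨[3, 8, 7, 9, 6, 4, 5], [], [9, 4, 8, 6, 3, 5, 7], [6, 7, 4, 3, 9, 8, 5], [(2, 6),
    (3, 5), (3, 6), (4, 6), (6, 8), (6, 9), (7, 9)]⟩
  | 8 => ⟨[9, 4, 10, 3, 6, 8, 7, 5], [], [3, 4, 6, 10, 7, 9, 8, 5], [10, 9, 3, 8, 4, 5, 6, 7],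
    [(2, 9), (3, 8), (3, 9), (4, 8), (4, 9), (5, 7), (5, 8), (6, 8)]⟩
  | 9 => ⟨[11, 9, 7, 8, 10, 6, 3, 4, 5], [], [10, 7, 5, 3, 11, 4, 6, 8, 9], [3, 7, 6, 5, 8, 4, 9,
    10, 11], [(4, 8), (4, 9), (4, 11), (5, 7), (5, 8), (6, 8), (9, 11)]⟩
  | 10 => ⟨[5, 4, 3, 9, 8, 7, 6, 10, 11, 12], [], [3, 12, 4, 9, 10, 7, 5, 11, 6, 8], [12, 9, 11,
    3, 7, 4, 6, 5, 10, 8], [(3, 7), (3, 9), (3, 11), (3, 12), (4, 6), (4, 7), (4, 9), (5, 7),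
    (9, 11), (9, 12)]⟩
  | 11 => ⟨[4, 6, 10, 12, 9, 11, 13, 3, 5, 8, 7], [], [3, 12, 11, 4, 10, 8, 9, 13, 5, 7, 6], [13,
    12, 8, 6, 5, 4, 3, 11, 10, 9, 7], [(3, 11), (3, 12), (3, 13), (4, 6), (4, 10), (4, 11),
    (6, 10), (7, 9), (8, 10), (11, 13)]⟩
  | 12 => ⟨[5, 6, 11, 9, 13, 14, 12, 8, 10, 7, 3, 4], [], [3, 6, 10, 9, 8, 7, 13, 12, 11, 14, 4,
    5], [4, 7, 6, 8, 13, 3, 14, 5, 11, 10, 12, 9], [(2, 4), (2, 5), (4, 14), (5, 11), (5, 14),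
    (6, 8), (6, 10), (6, 11), (7, 10), (8, 10), (11, 14), (12, 14)]⟩
  | 13 => ⟨[15, 14, 4, 3, 5, 6, 7, 12, 11, 13, 8, 10, 9], [], [4, 12, 14, 6, 8, 9, 7, 11, 10, 13,
    5, 15, 3], [3, 14, 13, 9, 11, 6, 12, 10, 7, 8, 5, 4, 15], [(3, 14), (3, 15), (4, 12), (4, 14),
    (4, 15), (6, 11), (6, 12), (6, 14), (7, 9), (7, 10), (7, 11), (7, 12), (9, 11), (12, 14)]⟩
  | _ => ⟨[], [], [], [], []⟩

/-- For `s` and `j`: `j` leaves at the head, then `s` spine vertices of degree two and a last leaf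
if `0 < s`; both paths end at the place `0`. -/
def endLayout : ℕ → ℕ → Layout
  | 0, 4 => ⟨[3, 4, 5, 6], [], [4, 5, 3, 6, 0], [3, 4, 6, 5, 0], [(3, 5), (3, 6), (4, 6)]⟩
  | 0, 5 => ⟨[3, 4, 5, 6, 7], [], [3, 5, 4, 6, 7, 0], [4, 3, 7, 5, 6, 0], [(3, 5), (3, 7),
    (5, 7)]⟩
  | 0, 6 => ⟨[3, 4, 5, 6, 7, 8], [], [4, 6, 5, 3, 7, 8, 0], [8, 6, 7, 5, 4, 3, 0], [(0, 3),
    (2, 8), (3, 5), (3, 7), (5, 7)]⟩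
  | 0, 7 => ⟨[3, 4, 5, 6, 7, 8, 9], [], [3, 4, 5, 9, 6, 7, 8, 0], [4, 6, 8, 9, 7, 5, 3, 0],
    [(0, 3), (2, 4), (4, 6), (5, 9), (6, 8), (6, 9), (7, 9)]⟩
  | 0, 8 => ⟨[3, 4, 5, 6, 7, 8, 9, 10], [], [10, 3, 4, 5, 6, 8, 7, 9, 0], [4, 6, 7, 5, 3, 8, 9,
    10, 0], [(2, 10), (3, 5), (3, 8), (3, 10), (5, 7), (6, 8)]⟩
  | 1, 3 => ⟨[4, 5, 7, 3, 6], [], [6, 5, 7, 4, 3, 0], [3, 5, 4, 6, 7, 0], [(0, 3), (2, 6), (3, 5),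
    (3, 6), (4, 6)]⟩
  | 1, 4 => ⟨[3, 4, 6, 7, 8, 5], [], [3, 4, 6, 5, 7, 8, 0], [4, 5, 3, 8, 6, 7, 0], [(3, 5),
    (3, 8), (5, 7), (5, 8), (6, 8)]⟩
  | 1, 5 => ⟨[3, 4, 7, 8, 9, 5, 6], [], [4, 6, 8, 9, 7, 5, 3, 0], [3, 4, 5, 8, 7, 6, 9, 0],
    [(0, 3), (2, 4), (4, 6), (6, 8), (6, 9), (7, 9)]⟩
  | 1, 6 => ⟨[3, 4, 5, 6, 7, 10, 8, 9], [], [4, 3, 10, 9, 6, 5, 7, 8, 0], [3, 5, 4, 9, 7, 6, 8,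
    10, 0], [(3, 5), (3, 10), (4, 9), (6, 8), (6, 9), (7, 9)]⟩
  | 1, 7 => ⟨[3, 4, 5, 6, 7, 10, 11, 9, 8], [], [3, 5, 4, 8, 6, 7, 10, 9, 11, 0], [4, 6, 5, 7, 9,
    3, 8, 11, 10, 0], [(3, 5), (3, 8), (3, 9), (4, 8), (5, 7), (6, 8), (8, 11), (9, 11)]⟩
  | 2, 2 => ⟨[4, 5, 3, 7, 6], [], [3, 6, 4, 5, 7, 0], [7, 4, 3, 5, 6, 0], [(2, 7), (3, 6), (3, 7),
    (4, 6), (4, 7)]⟩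
  | 2, 4 => ⟨[4, 5, 6, 9, 3, 7, 8], [], [3, 4, 7, 6, 5, 9, 8, 0], [4, 5, 3, 8, 6, 9, 7, 0],
    [(0, 7), (0, 8), (3, 5), (3, 7), (3, 8), (4, 7)]⟩
  | 2, 5 => ⟨[5, 7, 8, 9, 10, 6, 4, 3], [], [4, 9, 10, 6, 8, 7, 5, 3, 0], [3, 10, 8, 9, 7, 6, 5,
    4, 0], [(0, 3), (0, 4), (3, 10), (4, 6), (4, 9), (6, 8), (6, 10), (7, 9)]⟩
  | 2, 6 => ⟨[5, 7, 8, 9, 10, 11, 6, 4, 3], [], [3, 11, 9, 7, 8, 10, 6, 5, 4, 0], [4, 11, 10, 9,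
    8, 6, 7, 5, 3, 0], [(0, 3), (0, 4), (3, 11), (4, 6), (4, 11), (6, 8), (6, 10), (8, 10)]⟩
  | 3, 2 => ⟨[7, 8, 6, 3, 5, 4], [], [4, 6, 5, 8, 7, 3, 0], [3, 4, 8, 6, 7, 5, 0], [(0, 3),
    (0, 5), (2, 4), (4, 8), (5, 7), (5, 8), (6, 8)]⟩
  | 3, 4 => ⟨[3, 5, 7, 8, 6, 9, 10, 4], [], [4, 3, 5, 6, 7, 9, 8, 10, 0], [3, 6, 8, 7, 10, 5, 9,
    4, 0], [(0, 4), (2, 4), (4, 9), (4, 10), (5, 9), (5, 10), (6, 8), (6, 9), (7, 9)]⟩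
  | 3, 5 => ⟨[3, 8, 9, 10, 11, 7, 4, 6, 5], [], [4, 3, 7, 9, 10, 8, 6, 11, 5, 0], [3, 6, 7, 8, 9,
    11, 10, 5, 4, 0], [(0, 4), (0, 5), (2, 4), (5, 10), (5, 11), (6, 8), (6, 11), (8, 10)]⟩
  | 3, 6 => ⟨[4, 5, 8, 9, 10, 12, 3, 6, 7, 11], [], [4, 5, 3, 7, 12, 11, 9, 10, 8, 6, 0], [3, 4,
    6, 5, 9, 12, 10, 11, 8, 7, 0], [(0, 6), (0, 7), (3, 5), (3, 6), (3, 7), (4, 6), (7, 11),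
    (7, 12), (8, 10), (8, 11), (9, 11)]⟩
  | 4, 1 => ⟨[7, 3, 8, 4, 6, 5], [], [3, 4, 5, 7, 6, 8, 0], [6, 3, 5, 8, 7, 4, 0], [(0, 4),
    (3, 8), (4, 7), (4, 8), (5, 7), (5, 8)]⟩
  | 4, 4 => ⟨[3, 4, 6, 11, 5, 7, 9, 8, 10], [], [3, 8, 4, 5, 6, 7, 11, 10, 9, 0], [9, 11, 6, 10,
    7, 4, 3, 5, 8, 0], [(0, 8), (0, 9), (2, 9), (3, 8), (4, 7), (4, 8), (5, 7), (5, 8), (9, 11)]⟩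
  | 4, 5 => ⟨[3, 7, 9, 11, 12, 8, 10, 6, 5, 4], [], [5, 10, 12, 6, 9, 11, 8, 3, 7, 4, 0], [4, 3,
    6, 7, 8, 9, 10, 11, 12, 5, 0], [(0, 4), (0, 5), (2, 4), (2, 5), (5, 10), (5, 12), (6, 9),
    (6, 10), (6, 12), (8, 10), (10, 12)]⟩
  | 5, 1 => ⟨[3, 4, 5, 6, 7, 8, 9], [], [6, 3, 7, 5, 8, 4, 9, 0], [7, 9, 5, 3, 4, 6, 8, 0],
    [(0, 8), (2, 6), (2, 7), (3, 5), (3, 6), (3, 7), (4, 6), (7, 9)]⟩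
  | 5, 4 => ⟨[5, 9, 10, 12, 11, 7, 8, 6, 4, 3], [], [4, 12, 6, 11, 9, 8, 10, 7, 5, 3, 0], [3, 8,
    5, 6, 7, 9, 10, 12, 11, 4, 0], [(0, 3), (0, 4), (2, 4), (4, 6), (4, 11), (4, 12), (6, 11),
    (6, 12), (7, 9), (7, 10), (7, 11), (9, 11)]⟩
  | 5, 5 => ⟨[3, 5, 6, 10, 11, 9, 8, 7, 4, 13, 12], [], [3, 6, 9, 10, 11, 13, 8, 12, 7, 5, 4, 0],
    [4, 3, 5, 6, 8, 10, 12, 11, 9, 7, 13, 0], [(0, 4), (2, 4), (4, 7), (4, 13), (5, 7), (7, 12),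
    (7, 13), (8, 10), (8, 12), (8, 13), (10, 12)]⟩
  | _, _ => ⟨[], [], [], [], []⟩

/-- For `t`, `s` and `j`: as `endLayout s j`, and besides a path of `t + 1` vertices that hangs
from the place `0`. -/
def bothLayout : ℕ → ℕ → ℕ → Layout
  | 1, 1, 1 => ⟨[5, 4, 7], [3, 6], [4, 3, 7, 5, 6, 0], [3, 5, 4, 6, 7, 0], [(0, 3), (0, 6),
    (3, 5), (3, 6), (3, 7), (4, 6)]⟩
  | 1, 1, 4 => ⟨[5, 6, 8, 9, 4, 3], [7, 10], [4, 5, 7, 8, 6, 9, 10, 3, 0], [3, 5, 6, 4, 7, 9, 8,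
    10, 0], [(0, 3), (0, 7), (3, 5), (3, 10), (4, 7), (5, 7), (7, 9), (7, 10), (8, 10)]⟩
  | 1, 1, 5 => ⟨[3, 4, 5, 6, 7, 8, 11], [9, 10], [3, 5, 4, 9, 8, 6, 7, 11, 10, 0], [10, 8, 7, 5,
    6, 4, 3, 9, 11, 0], [(0, 9), (0, 10), (2, 10), (3, 9), (4, 6), (4, 9), (6, 8)]⟩
  | 2, 1, 0 => ⟨[7, 5], [3, 4, 6], [7, 4, 5, 3, 6, 0], [3, 7, 6, 5, 0, 4], [(0, 3), (0, 4),
    (0, 5), (0, 6), (3, 5), (5, 7)]⟩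
  | 2, 1, 4 => ⟨[3, 5, 10, 11, 9, 8], [6, 4, 7], [4, 3, 5, 8, 6, 9, 11, 10, 7, 0], [3, 9, 10, 8,
    11, 7, 6, 5, 4, 0], [(0, 4), (0, 6), (0, 7), (2, 4), (4, 6), (4, 7), (7, 10), (7, 11),
    (8, 10), (8, 11)]⟩
  | 2, 2, 0 => ⟨[4, 7, 8], [3, 6, 5], [5, 8, 3, 4, 6, 0, 7], [3, 7, 6, 8, 0, 5, 4], [(0, 3),
    (0, 7), (3, 6), (3, 7), (3, 8), (4, 6), (4, 7)]⟩
  | 2, 2, 4 => ⟨[4, 5, 7, 9, 6, 10, 8], [11, 12, 3], [4, 5, 6, 8, 0, 3, 11, 10, 7, 9, 12], [5, 3,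
    4, 11, 6, 7, 8, 9, 10, 0, 12], [(0, 3), (0, 11), (3, 5), (3, 11), (3, 12), (4, 11), (6, 10),
    (6, 11), (7, 9), (7, 10), (8, 10)]⟩
  | 3, 1, 0 => ⟨[6, 7], [4, 3, 8, 5], [6, 8, 0, 3, 5, 7, 4], [3, 6, 5, 4, 8, 7, 0], [(0, 3),
    (0, 4), (3, 8), (4, 7), (4, 8), (5, 7), (5, 8)]⟩
  | 3, 1, 4 => ⟨[3, 9, 10, 11, 8, 4], [6, 7, 5, 12], [3, 8, 7, 9, 11, 12, 10, 6, 4, 5, 0], [8, 9,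
    10, 11, 6, 5, 3, 7, 4, 0, 12], [(0, 4), (0, 5), (0, 6), (3, 5), (5, 12), (6, 10), (6, 11),
    (7, 9), (10, 12)]⟩
  | 3, 2, 0 => ⟨[7, 5, 3], [9, 4, 6, 8], [6, 5, 8, 4, 0, 3, 7, 9], [7, 6, 3, 4, 5, 9, 8, 0],
    [(0, 3), (0, 4), (4, 8), (4, 9), (5, 7), (5, 8), (5, 9), (6, 8)]⟩
  | 3, 2, 4 => ⟨[3, 4, 5, 6, 7, 8, 9], [10, 11, 12, 13], [4, 6, 9, 7, 13, 0, 11, 8, 12, 10, 5, 3],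
    [3, 4, 5, 6, 7, 10, 9, 11, 13, 8, 0, 12], [(0, 10), (0, 11), (0, 12), (3, 5), (5, 10), (6, 9),
    (7, 9), (7, 10), (10, 12)]⟩
  | 3, 3, 0 => ⟨[3, 8, 9, 7], [4, 5, 6, 10], [8, 6, 7, 3, 5, 9, 0, 10, 4], [4, 3, 6, 9, 10, 5, 7,
    8, 0], [(0, 4), (2, 4), (4, 10), (5, 9), (5, 10), (6, 8), (6, 9), (6, 10), (7, 9)]⟩
  | 3, 3, 4 => ⟨[8, 9, 10, 14, 4, 6, 5, 3], [7, 13, 12, 11], [4, 3, 6, 7, 5, 8, 12, 9, 11, 14, 10,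
    13, 0], [3, 0, 6, 8, 7, 12, 10, 11, 13, 14, 9, 5, 4], [(0, 3), (0, 6), (0, 7), (0, 13),
    (3, 5), (3, 6), (4, 6), (7, 12), (7, 13), (8, 12), (9, 11), (9, 12), (10, 12)]⟩
  | _, _, _ => ⟨[], [], [], [], []⟩

/-- Eight more vertices of a path, with the head at the last place. -/
def eightLayout : Layout :=
  ⟨[6, 7, 4, 5, 9, 8, 3, 10], [], [5, 6, 8, 4, 3, 7, 9, 10], [4, 6, 9, 3, 5, 7, 8, 10],
    [(2, 4), (2, 5), (2, 6), (3, 5), (5, 9), (6, 8), (6, 9), (7, 9)]⟩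

/-- The tags of `j` leaves. -/
abbrev leaves (j : ℕ) : List Bool := List.replicate j false

/-- The tags of a run of `r` spine vertices. -/
abbrev run (r : ℕ) : List Bool := List.replicate r true

lemma legLayout_extends : ∀ k < 10, 5 ≤ k →
    Gadget.Extends ⟨legLayout k, leaves k⟩ 1 1 true := by decide +kernel

lemma legLayout_extends_run : ∀ k < 10, 5 ≤ k →
    Gadget.Extends ⟨legLayout k, leaves (k - 1) ++ [true]⟩ 1 (k + 2) true := by decide +kernel

/-- The local place of the new head. -/
def Gadget.newHead (g : Gadget) (h : ℕ) : ℕ := lastHead h (g.tags.zip g.tree)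

lemma turnLayout_extends : ∀ r < 7, ∀ j < 8, j = min 3 (6 - r) ∨ 4 ≤ j ∧ j ≤ min 3 (6 - r) + 4 →
    let g : Gadget := ⟨turnLayout r j, leaves j ++ run (r + 1) ++ [false]⟩
    g.Extends 1 (g.newHead 1) false ∧ 3 ≤ g.newHead 1 ∧ g.newHead 1 < g.size + 2 := by
  decide +kernel

lemma runLayout_extends : ∀ t < 15, 7 ≤ t →
    let g : Gadget := ⟨runLayout t, run t ++ [false]⟩
    g.Extends 2 (g.newHead 2) true ∧ 3 ≤ g.newHead 2 ∧ g.newHead 2 < g.size + 2 := by decide +kernel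

lemma eightLayout_extends : Gadget.Extends ⟨eightLayout, run 8⟩ 2 10 true := by decide +kernel

lemma tailLayout_completes : ∀ t < 14, 6 ≤ t →
    Gadget.Completes ⟨tailLayout t, run (t - 1) ++ [false]⟩ 0 2 true := by decide +kernel

/-- A number of leaves such that `endLayout s` has a gadget with so many leaves and with each
number of leaves between `4` and `endSpare s + 4`. -/
def endSpare (s : ℕ) : ℕ := [4, 3, 2, 2, 1, 1].getD s 0

/-- The tags that end a caterpillar after its last vertex of degree more than two: `s` spine
vertices of degree two, and a last leaf if `0 < s`. -/
def endRun : ℕ → List Bool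
  | 0 => []
  | s + 1 => run (s + 1) ++ [false]

lemma endLayout_completes : ∀ s < 4, ∀ j < 9, j = endSpare s ∨ 4 ≤ j ∧ j ≤ endSpare s + 4 →
    Gadget.Completes ⟨endLayout s j, leaves j ++ endRun s⟩ 1 1 (decide (2 ≤ s)) := by
  decide +kernel

/-- When no vertex is missing in the paths, their last vertex, the place `0`, is left out. -/
lemma endLayout_dropLast_completes : ∀ s < 6, ∀ j < 9,
    j = endSpare s ∨ 4 ≤ j ∧ j ≤ endSpare s + 4 →
    Gadget.Completes ⟨{ endLayout s j with
      p := (endLayout s j).p.dropLast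
      q := (endLayout s j).q.dropLast }, leaves j ++ endRun s⟩ 0 1 true := by
  decide +kernel

set_option synthInstance.maxSize 1000 in
lemma bothLayout_completes : ∀ t < 4, ∀ s < 4, ∀ j < 6,
    1 ≤ s ∧ s ≤ t → (j = 2 - t ∨ 4 ≤ j ∧ j ≤ 2 - t + 4) →
    Gadget.Completes ⟨bothLayout t s j, leaves j ++ endRun s⟩ 1 1 true := by
  decide +kernel

set_option synthInstance.maxSize 1000 in
lemma length_pend_bothLayout : ∀ t < 4, ∀ s < 4, ∀ j < 6,
    1 ≤ s ∧ s ≤ t → (j = 2 - t ∨ 4 ≤ j ∧ j ≤ 2 - t + 4) →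
    (bothLayout t s j).pend.length = t + 1 := by
  decide +kernel

/-! ### Assembling the gadgets -/

/-- There is a partial packing of the caterpillar with the tags `w` whose head is the last place
if `h = 2` and an earlier place if `h = 1`. If `z` is false, the head is not at the place `0`.
The number `c` has the same meaning as in `Partial`. -/
def Open (c : ℕ) (w : List Bool) (h : ℕ) (z : Bool) : Prop :=
  ∃ x₀ r p q D v side, Partial c w x₀ r p q D v side ∧
    (h = 1 ∧ v < w.length ∨ h = 2 ∧ v = w.length) ∧ (z = true ∨ v ≠ 0)

section Assembly

variable {c h h' : ℕ} {w : List Bool} {z s : Bool} {g : Gadget}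

lemma Gadget.Extends.size_eq (hg : g.Extends h h' s) : g.size = g.tags.length := by
  simp [Gadget.size, hg.pend, hg.length]

/-- Gluing a gadget with the same head. -/
lemma Open.extend_same (o : Open c w 1 z) (hg : g.Extends 1 1 s) : Open c (w ++ g.tags) 1 z := by
  obtain ⟨x₀, r, p, q, D, v, side, P, hh, hz⟩ := o
  have hv : v < w.length := by omega
  refine ⟨_, _, _, _, _, _, _, P.extend hg hh, Or.inl ⟨rfl, ?_⟩, hz⟩
  simp only [glue, List.length_append]
  exact Nat.lt_add_right _ hv

/-- Gluing a gadget whose new head is a new place, but not the last one. -/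
lemma Open.extend_new (o : Open c w h z) (hg : g.Extends h h' s) (h3 : 3 ≤ h')
    (hlt : h' < g.size + 2) : Open c (w ++ g.tags) 1 false := by
  obtain ⟨x₀, r, p, q, D, v, side, P, hh, hz⟩ := o
  rw [hg.size_eq] at hlt
  refine ⟨_, _, _, _, _, _, _, P.extend hg hh, Or.inl ⟨rfl, ?_⟩, Or.inr ?_⟩
  · rw [List.length_append]; unfold glue; split_ifs <;> omega
  · unfold glue; split_ifs <;> omega

/-- Gluing a gadget whose new head is the last place. -/
lemma Open.extend_last (o : Open c w h z) (hg : g.Extends h h' s) (h3 : 3 ≤ h')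
    (heq : h' = g.size + 2) : Open c (w ++ g.tags) 2 false := by
  obtain ⟨x₀, r, p, q, D, v, side, P, hh, hz⟩ := o
  rw [hg.size_eq] at heq
  refine ⟨_, _, _, _, _, _, _, P.extend hg hh, Or.inr ⟨rfl, ?_⟩, Or.inr ?_⟩
  · rw [List.length_append]; unfold glue; split_ifs <;> omega
  · unfold glue; split_ifs <;> omega

lemma Open.complete {d : Bool} (o : Open c w h z) (hg : g.Completes c h d)
    (hd : d = true ∨ z = false) :
    Realizable (List.replicate g.pend.length true ++ (w ++ g.tags)) := by
  obtain ⟨x₀, r, p, q, D, v, side, P, hh, hz⟩ := o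
  refine P.complete hg hh (hd.imp_right fun h => hz.resolve_left ?_)
  simp [h]

lemma leaves_add (a b : ℕ) : leaves (a + b) = leaves a ++ leaves b := List.replicate_add _ _ _

lemma run_add (a b : ℕ) : run (a + b) = run a ++ run b := List.replicate_add _ _ _

lemma Open.legs (o : Open c w 1 z) {k : ℕ} (hk : 5 ≤ k) : Open c (w ++ leaves k) 1 z := by
  induction k using Nat.strong_induction_on generalizing w with
  | _ k ih =>
    rcases lt_or_ge k 10 with h | h
    · exact o.extend_same (legLayout_extends k h hk)
    · obtain ⟨m, rfl⟩ : ∃ m, k = 5 + m := ⟨k - 5, by omega⟩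
      rw [leaves_add, ← List.append_assoc]
      exact ih m (by omega) (o.extend_same (legLayout_extends 5 (by omega) le_rfl)) (by omega)

/-- After at least four leaves, the next spine vertex can be the last place. -/
lemma Open.legs_run (o : Open c w 1 z) {k : ℕ} (hk : 4 ≤ k) :
    Open c (w ++ (leaves k ++ [true])) 2 false := by
  have key : ∀ {w : List Bool}, Open c w 1 z → ∀ k, 4 ≤ k → k < 9 →
      Open c (w ++ (leaves k ++ [true])) 2 false := fun o k h1 h2 =>
    have hg := legLayout_extends_run (k + 1) (by omega) (by omega)
    o.extend_last hg (by omega) (by rw [hg.size_eq]; simp)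
  rcases lt_or_ge k 9 with h | h
  · exact key o k hk h
  · obtain ⟨m, rfl⟩ : ∃ m, k = m + 4 := ⟨k - 4, by omega⟩
    rw [leaves_add, List.append_assoc, ← List.append_assoc]
    exact key (o.legs (by omega)) 4 le_rfl (by omega)

lemma Open.eight (o : Open c w 2 z) : Open c (w ++ run 8) 2 false :=
  o.extend_last eightLayout_extends (by omega) rfl

lemma Open.run (o : Open c w 2 z) {t : ℕ} (ht : 7 ≤ t) :
    Open c (w ++ (run t ++ [false])) 1 false := by
  induction t using Nat.strong_induction_on generalizing w z with
  | _ t ih =>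
    rcases lt_or_ge t 15 with h | h
    · obtain ⟨hg, h3, hlt⟩ := runLayout_extends t h ht
      exact o.extend_new hg h3 hlt
    · obtain ⟨m, rfl⟩ : ∃ m, t = 8 + m := ⟨t - 8, by omega⟩
      rw [run_add, List.append_assoc, ← List.append_assoc]
      exact ih m (by omega) o.eight (by omega)

lemma Open.tail (o : Open 0 w 2 z) {t : ℕ} (ht : 5 ≤ t) :
    Realizable (w ++ (OnePlanarPacking.run t ++ [false])) := by
  induction t using Nat.strong_induction_on generalizing w z with
  | _ t ih =>
    rcases lt_or_ge t 13 with h | h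
    · have hg := tailLayout_completes (t + 1) (by omega) (by omega)
      have h0 := hg.pend.resolve_right (by omega)
      have := o.complete hg (Or.inl rfl)
      rw [h0] at this
      exact this
    · obtain ⟨m, rfl⟩ : ∃ m, t = 8 + m := ⟨t - 8, by omega⟩
      rw [run_add, List.append_assoc, ← List.append_assoc]
      exact ih m (by omega) o.eight (by omega)

/-- Leaves can be attached until `j` of the planned `R` leaves are left, where either `j` is a
prescribed number `e`, or `j` lies between `4` and `e + 4`. -/
lemma Open.split_legs (o : Open c w 1 z) {R : ℕ} (hR : 4 ≤ R) (e : ℕ) :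
    ∃ j w', (j = e ∨ 4 ≤ j ∧ j ≤ e + 4) ∧ Open c w' 1 z ∧ w ++ leaves R = w' ++ leaves j := by
  rcases le_or_gt R (e + 4) with h | h
  · exact ⟨R, w, Or.inr ⟨hR, h⟩, o, rfl⟩
  · refine ⟨e, w ++ leaves (R - e), Or.inl rfl, o.legs (by omega), ?_⟩
    rw [List.append_assoc, ← leaves_add, Nat.sub_add_cancel (by omega)]

/-- From one vertex with legs to the next one, with `r` vertices of degree two between them. -/
lemma Open.turn (o : Open c w 1 z) {R : ℕ} (hR : 4 ≤ R) (r : ℕ) :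
    Open c (w ++ (leaves R ++ (OnePlanarPacking.run (r + 1) ++ [false]))) 1 false := by
  rcases lt_or_ge r 7 with h | h
  · obtain ⟨j, w', hj, o', hw⟩ := o.split_legs hR (min 3 (6 - r))
    obtain ⟨hg, h3, hlt⟩ := turnLayout_extends r h j (by omega) hj
    have := o'.extend_new hg h3 hlt
    rw [← List.append_assoc, hw]
    simpa only [List.append_assoc] using this
  · have := (o.legs_run hR).run h
    rw [Nat.add_comm, run_add, show OnePlanarPacking.run 1 = [true] from rfl]
    simpa only [List.append_assoc] using this

/-- The tags of a sequence of pairs `(r, l)`, each standing for `r` spine vertices of degree two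
and one spine vertex with `l` leaves. -/
def blocks (bs : List (ℕ × ℕ)) : List Bool := bs.flatMap fun b => run (b.1 + 1) ++ leaves b.2

lemma Open.blocks (bs : List (ℕ × ℕ)) (o : Open c w 1 z) {R : ℕ} (hR : 4 ≤ R)
    (hbs : ∀ b ∈ bs, 5 ≤ b.2) :
    ∃ w' R' z', Open c w' 1 z' ∧ 4 ≤ R' ∧ (bs ≠ [] ∨ z = false → z' = false) ∧
      w ++ (leaves R ++ OnePlanarPacking.blocks bs) = w' ++ leaves R' := by
  induction bs generalizing w R z with
  | nil => exact ⟨w, R, z, o, hR, by simp, by simp [OnePlanarPacking.blocks]⟩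
  | cons b bs ih =>
    obtain ⟨r, l⟩ := b
    have hl : 5 ≤ l := hbs (r, l) (by simp)
    obtain ⟨w', R', z', o', hR', hz', hw⟩ := ih (o.turn hR r) (R := l - 1) (by omega)
      fun b hb => hbs b (by simp [hb])
    refine ⟨w', R', z', o', hR', fun _ => hz' (Or.inr rfl), ?_⟩
    rw [← hw]
    have : leaves l = [false] ++ leaves (l - 1) := by
      rw [show [false] = leaves 1 from rfl, ← leaves_add]; congr 1; omega
    simp only [OnePlanarPacking.blocks, List.flatMap_cons, this, List.append_assoc]

lemma pend_endLayout (s j : ℕ) : (endLayout s j).pend = [] := by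
  unfold endLayout; split <;> rfl

/-- The end of the caterpillar, when no vertex is missing in the paths. -/
lemma Open.finish (o : Open 0 w 1 z) {R : ℕ} (hR : 4 ≤ R) (s : ℕ) :
    Realizable (w ++ (leaves R ++ endRun s)) := by
  rcases lt_or_ge s 6 with h | h
  · obtain ⟨j, w', hj, o', hw⟩ := o.split_legs hR (endSpare s)
    have he : endSpare s ≤ 4 := by interval_cases s <;> decide
    have := o'.complete (endLayout_dropLast_completes s h j (by omega) hj) (Or.inl rfl)
    rw [← List.append_assoc, hw]
    simpa only [pend_endLayout, List.length_nil, List.replicate_zero, List.nil_append,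
      List.append_assoc] using this
  · obtain ⟨t, rfl⟩ : ∃ t, s = t + 1 := ⟨s - 1, by omega⟩
    have := (o.legs_run hR).tail (t := t) (by omega)
    rw [endRun, Nat.add_comm, run_add, show OnePlanarPacking.run 1 = [true] from rfl]
    simpa only [List.append_assoc] using this

/-- The end of the caterpillar, when the first vertex is still missing in the paths. -/
lemma Open.finish_first (o : Open 1 w 1 z) {R : ℕ} (hR : 4 ≤ R) {s : ℕ} (hs : s < 4)
    (hz : 2 ≤ s ∨ z = false) : Realizable (w ++ (leaves R ++ endRun s)) := by
  obtain ⟨j, w', hj, o', hw⟩ := o.split_legs hR (endSpare s)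
  have he : endSpare s ≤ 4 := by interval_cases s <;> decide
  have := o'.complete (endLayout_completes s hs j (by omega) hj) (by simpa using hz)
  rw [← List.append_assoc, hw]
  simpa only [pend_endLayout, List.length_nil, List.replicate_zero, List.nil_append,
    List.append_assoc] using this

/-- The end of the caterpillar and, attached to the place `0`, its beginning with `t` vertices of
degree two and a leaf. -/
lemma Open.finish_both (o : Open 1 w 1 z) {R : ℕ} (hR : 4 ≤ R) {s t : ℕ} (hs : 1 ≤ s)
    (hst : s ≤ t) (ht : t < 4) :
    Realizable (OnePlanarPacking.run (t + 1) ++ (w ++ (leaves R ++ endRun s))) := by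
  obtain ⟨j, w', hj, o', hw⟩ := o.split_legs hR (2 - t)
  have hj6 : j < 6 := by omega
  have := o'.complete (bothLayout_completes t ht s (by omega) j hj6 ⟨hs, hst⟩ hj) (Or.inl rfl)
  rw [show (Gadget.mk _ _).pend = _ from rfl,
    length_pend_bothLayout t ht s (by omega) j hj6 ⟨hs, hst⟩ hj] at this
  rw [← List.append_assoc w, hw]
  simpa only [List.append_assoc] using this

end Assembly

/-- A single vertex, which is visited by the paths. -/
lemma open_vertex : Open 0 [] 2 true :=
  ⟨0, [], [0], [0], [], 0, true,
    ⟨rfl, by decide, by decide, by decide, ⟨[], rfl⟩, ⟨[], rfl⟩, by decide, by decide,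
      by unfold OneCross; decide, by decide, rfl, by decide, by decide⟩,
    by decide, Or.inl rfl⟩

/-- A vertex at the place `0`, still missing in the paths, and a leaf. -/
lemma open_leaf : Open 1 [false] 1 true :=
  ⟨0, [(false, 1)], [1], [1], [((0, 1), true)], 0, true,
    ⟨rfl, by decide, by decide, by decide, ⟨[], rfl⟩, ⟨[], rfl⟩, by decide, by decide,
      by unfold OneCross; decide, by decide, rfl, by decide, by decide⟩,
    by decide, Or.inl rfl⟩

/-- The edges of a caterpillar and two paths, drawn in two pages; the edges in `bot` lie in the
page `false`. -/
def drawAll (x₀ : ℕ) (r : List (Bool × ℕ)) (p q : List ℕ) (bot : List (ℕ × ℕ)) :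
    List ((ℕ × ℕ) × Bool) :=
  (treeEdges x₀ r ++ pathEdges p ++ pathEdges q).map fun e => (norm e, !(bot.contains (norm e)))

lemma drawAll_cover (x₀ : ℕ) (r : List (Bool × ℕ)) (p q : List ℕ) (bot : List (ℕ × ℕ)) :
    ∀ e ∈ treeEdges x₀ r ++ pathEdges p ++ pathEdges q,
      ∃ s, (norm e, s) ∈ drawAll x₀ r p q bot :=
  fun _ he => ⟨_, List.mem_map_of_mem he⟩

instance (D : List ((ℕ × ℕ) × Bool)) : Decidable (OneCross D) := by
  unfold OneCross; infer_instance

lemma open_run_five : Open 0 (run 5 ++ [false]) 1 true :=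
  ⟨2, (run 5 ++ [false]).zip [5, 0, 3, 4, 1, 6], [3, 2, 4, 5, 1, 0, 6], [4, 0, 2, 1, 3, 5, 6],
    drawAll 2 ((run 5 ++ [false]).zip [5, 0, 3, 4, 1, 6]) [3, 2, 4, 5, 1, 0, 6]
      [4, 0, 2, 1, 3, 5, 6] [(0, 2), (0, 3), (0, 4), (0, 5), (0, 6), (1, 3), (3, 5)], 1, true,
    ⟨by decide, by decide, by decide, by decide, ⟨[3, 2, 4, 5, 1, 0], rfl⟩,
      ⟨[4, 0, 2, 1, 3, 5], rfl⟩, by decide +kernel, drawAll_cover _ _ _ _ _,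
      by decide +kernel, by decide +kernel, by decide, by decide +kernel, by decide⟩,
    by decide, Or.inl rfl⟩

lemma open_run_six : Open 0 (run 6 ++ [false]) 1 true :=
  ⟨1, (run 6 ++ [false]).zip [2, 6, 3, 5, 4, 0, 7], [6, 5, 0, 2, 4, 1, 3, 7],
    [5, 1, 0, 6, 4, 3, 2, 7],
    drawAll 1 ((run 6 ++ [false]).zip [2, 6, 3, 5, 4, 0, 7]) [6, 5, 0, 2, 4, 1, 3, 7]
      [5, 1, 0, 6, 4, 3, 2, 7] [(0, 4), (0, 5), (0, 6), (1, 3), (1, 4), (1, 5), (2, 4)], 0, true,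
    ⟨by decide, by decide, by decide, by decide, ⟨[6, 5, 0, 2, 4, 1, 3], rfl⟩,
      ⟨[5, 1, 0, 6, 4, 3, 2], rfl⟩, by decide +kernel, drawAll_cover _ _ _ _ _,
      by decide +kernel, by decide +kernel, by decide, by decide +kernel, by decide⟩,
    by decide, Or.inl rfl⟩

/-- A leaf, `t - 1` vertices of degree two, and a head with a first leaf. -/
lemma open_run {t : ℕ} (ht : 5 ≤ t) : Open 0 (run t ++ [false]) 1 true := by
  rcases (by omega : t = 5 ∨ t = 6 ∨ 7 ≤ t) with rfl | rfl | h
  · exact open_run_five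
  · exact open_run_six
  · obtain ⟨x₀, r, p, q, D, v, side, P, hh, hz⟩ := open_vertex.run h
    exact ⟨x₀, r, p, q, D, v, side, P, hh, Or.inl rfl⟩

/-- The tags of a path. -/
lemma realizable_path {k : ℕ} (hk : 4 ≤ k) : Realizable (run k ++ [false]) := by
  rcases (by omega : k = 4 ∨ 5 ≤ k) with rfl | h
  · exact ⟨4, (run 4 ++ [false]).zip [3, 2, 1, 5, 0], [3, 1, 0, 4, 2, 5], [2, 0, 3, 5, 4, 1],
      drawAll 4 ((run 4 ++ [false]).zip [3, 2, 1, 5, 0]) [3, 1, 0, 4, 2, 5] [2, 0, 3, 5, 4, 1]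
        [(0, 3), (0, 4), (1, 3), (1, 4)],
      by decide, by decide, by decide, by decide, by decide +kernel, drawAll_cover _ _ _ _ _,
      by decide +kernel⟩
  · exact open_vertex.tail h

/-- The tags that start a caterpillar before its first vertex with legs: `t` spine vertices of
degree two. If `0 < t`, the first vertex is a leaf. -/
def startRun (t : ℕ) : List Bool := if t = 0 then [] else run (t + 1)

/-- The caterpillars with at least one vertex with legs, up to reversal. -/
lemma realizable_caterpillar {t l s : ℕ} {bs : List (ℕ × ℕ)} (hl : 5 ≤ l)
    (hbs : ∀ b ∈ bs, 5 ≤ b.2) (hstar : t = 0 → bs = [] → 2 ≤ s)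
    (hts : 4 ≤ t ∨ t = 0 ∧ s < 4 ∨ 1 ≤ s ∧ s ≤ t) :
    Realizable (startRun t ++ (leaves l ++ (blocks bs ++ endRun s))) := by
  have hl' : leaves l = [false] ++ leaves (l - 1) := by
    rw [show [false] = leaves 1 from rfl, ← leaves_add]; congr 1; omega
  rw [hl']
  rcases lt_or_ge t 4 with h4 | h4
  · obtain ⟨w, R, z, o, hR, hz, hw⟩ := open_leaf.blocks bs (R := l - 1) (by omega) hbs
    have hw' : [false] ++ leaves (l - 1) ++ (blocks bs ++ endRun s) =
        w ++ (leaves R ++ endRun s) := by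
      rw [← List.append_assoc w, ← hw]; simp only [List.append_assoc]
    rw [hw']
    rcases Nat.eq_zero_or_pos t with rfl | ht
    · rw [startRun, if_pos rfl, List.nil_append]
      refine o.finish_first hR (by omega) ?_
      by_cases hb : bs = []
      · exact Or.inl (hstar rfl hb)
      · exact Or.inr (hz (Or.inl hb))
    · rw [startRun, if_neg (by omega)]
      exact o.finish_both hR (by omega) (by omega) h4
  · obtain ⟨w, R, z, o, hR, -, hw⟩ :=
      (open_run (t := t + 1) (by omega)).blocks bs (R := l - 1) (by omega) hbs
    have := o.finish hR s
    rw [← List.append_assoc, ← hw] at this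
    rw [startRun, if_neg (by omega)]
    simpa only [List.append_assoc] using this

/-! ### From the numbers of leaves to tags -/

/-- The first vertex and the leaf that follows it may be exchanged. -/
lemma Realizable.swap {w : List Bool} (h : Realizable (true :: w)) : Realizable (false :: w) := by
  obtain ⟨x₀, r, p, q, D, hr, hperm, hp, hq, hnd, hcov, hD⟩ := h
  obtain ⟨⟨s, x⟩, r, rfl⟩ : ∃ a r', r = a :: r' := by
    cases r with
    | nil => simp at hr
    | cons a r => exact ⟨a, r, rfl⟩
  simp only [List.map_cons, List.cons.injEq] at hr
  obtain ⟨rfl, hr⟩ := hr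
  have hE : (treeEdges x ((false, x₀) :: r)).map norm = (treeEdges x₀ ((true, x) :: r)).map norm :=
    by simp [treeEdges, norm_swap x x₀]
  have hE' : (treeEdges x ((false, x₀) :: r) ++ pathEdges p ++ pathEdges q).map norm =
      (treeEdges x₀ ((true, x) :: r) ++ pathEdges p ++ pathEdges q).map norm := by
    simp only [List.map_append, hE]
  refine ⟨x, (false, x₀) :: r, p, q, D, by simp [hr], (List.Perm.swap _ _ _).trans hperm, hp, hq,
    hE' ▸ hnd, fun e he => ?_, hD⟩
  have := List.mem_map_of_mem (f := norm) he
  rw [hE'] at this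
  obtain ⟨e', he', h⟩ := List.mem_map.1 this
  exact h ▸ hcov e' he'

/-- The tags of spine vertices with given numbers of leaves. -/
def spineTags (ks : List ℕ) : List Bool := ks.flatMap fun k => true :: leaves k

/-- The tags of a caterpillar, given the numbers of leaves at its spine vertices. The first spine
vertex is the first vertex and has no tag. -/
def word (ks : List ℕ) : List Bool := (spineTags ks).tail

/-- The numbers of leaves at the spine vertices that follow the last one with legs: `s` vertices
of degree two. -/
def endList : ℕ → List ℕ
  | 0 => []
  | s + 1 => List.replicate s 0 ++ [1]

/-- The numbers of leaves at the spine vertices that `blocks bs` stands for. -/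
def blockList (bs : List (ℕ × ℕ)) : List ℕ := bs.flatMap fun b => List.replicate b.1 0 ++ [b.2]

lemma spineTags_append (ks ks' : List ℕ) :
    spineTags (ks ++ ks') = spineTags ks ++ spineTags ks' := List.flatMap_append

lemma spineTags_replicate_zero (r : ℕ) : spineTags (List.replicate r 0) = run r := by
  induction r with
  | zero => rfl
  | succ r ih => rw [List.replicate_succ, run, List.replicate_succ, ← run, ← ih]; rfl

lemma spineTags_endList (s : ℕ) : spineTags (endList s) = endRun s := by
  cases s with
  | zero => rfl
  | succ s =>
    rw [endList, spineTags_append, spineTags_replicate_zero, endRun, run_add, List.append_assoc]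
    rfl

lemma spineTags_blockList (bs : List (ℕ × ℕ)) : spineTags (blockList bs) = blocks bs := by
  induction bs with
  | nil => rfl
  | cons b bs ih =>
    have : run b.1 ++ spineTags [b.2] = run (b.1 + 1) ++ leaves b.2 := by
      rw [run_add, List.append_assoc]; simp [spineTags]
    rw [blockList, List.flatMap_cons, ← blockList, spineTags_append, ih, spineTags_append,
      spineTags_replicate_zero, this]
    rfl

/-- Every list of numbers of leaves of the given kind splits into blocks and an end run. -/
lemma exists_eq_blockList_append_endList {ks : List ℕ} (hks : ∀ k ∈ ks, k = 0 ∨ 5 ≤ k) {x : ℕ}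
    (hx : x = 1 ∨ 5 ≤ x) :
    ∃ bs s, (∀ b ∈ bs, 5 ≤ b.2) ∧ ks ++ [x] = blockList bs ++ endList s := by
  induction ks with
  | nil =>
    rcases hx with rfl | hx
    · exact ⟨[], 1, by simp, rfl⟩
    · exact ⟨[(0, x)], 0, by simpa, rfl⟩
  | cons a ks ih =>
    obtain ⟨bs, s, hbs, h⟩ := ih fun k hk => hks k (by simp [hk])
    rcases hks a (by simp) with rfl | ha
    · rcases bs with _ | ⟨⟨r, l⟩, bs⟩
      · rcases s with _ | s
        · simp [blockList, endList] at h
        · refine ⟨[], s + 2, by simp, ?_⟩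
          rw [List.cons_append, h]; rfl
      · refine ⟨(r + 1, l) :: bs, s, ?_, ?_⟩
        · intro b hb
          rcases List.mem_cons.1 hb with rfl | hb
          · exact hbs (r, l) (by simp)
          · exact hbs b (by simp [hb])
        · rw [List.cons_append, h]; rfl
    · refine ⟨(0, a) :: bs, s, ?_, ?_⟩
      · intro b hb
        rcases List.mem_cons.1 hb with rfl | hb
        exacts [ha, hbs b hb]
      · rw [List.cons_append, h]; rfl

/-- Between the first and the last vertex with legs, the reversed caterpillar has the same form. -/
lemma exists_reverse_eq_blockList {bs : List (ℕ × ℕ)} (hbs : ∀ b ∈ bs, 5 ≤ b.2) {l : ℕ}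
    (hl : 5 ≤ l) : ∃ l' bs', 5 ≤ l' ∧ (∀ b ∈ bs', 5 ≤ b.2) ∧
      (l :: blockList bs).reverse = l' :: blockList bs' := by
  induction bs generalizing l with
  | nil => exact ⟨l, [], hl, by simp, rfl⟩
  | cons b bs ih =>
    obtain ⟨l', bs', hl', hbs', h⟩ := ih (fun b hb => hbs b (by simp [hb])) (hbs b (by simp))
    refine ⟨l', bs' ++ [(b.1, l)], hl', ?_, ?_⟩
    · intro b' hb'
      rcases List.mem_append.1 hb' with hb' | hb'
      · exact hbs' b' hb'
      · rw [List.mem_singleton.1 hb']; exact hl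
    · have : l :: blockList (b :: bs) = [l] ++ List.replicate b.1 0 ++ (b.2 :: blockList bs) := by
        simp [blockList]
      rw [this, List.reverse_append, h]
      simp [blockList]

/-- The numbers of leaves at the spine vertices of a `5`-legged caterpillar with at least six
vertices whose degrees are at most the number of vertices minus three. -/
structure IsLegList (ks : List ℕ) : Prop where
  six_le : 6 ≤ ks.length + ks.sum
  two_le : 2 ≤ ks.length
  of_length : ks.length = 2 → ∀ k ∈ ks, 2 ≤ k
  degree : ∀ as k bs, ks = as ++ k :: bs →
    k + min as.length 1 + min bs.length 1 = 2 ∨ 7 ≤ k + min as.length 1 + min bs.length 1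

lemma realizable_word_of_blocks {t l s : ℕ} {bs : List (ℕ × ℕ)} (hl : 5 ≤ l)
    (hbs : ∀ b ∈ bs, 5 ≤ b.2) {ks : List ℕ}
    (hks : ks = (endList t).reverse ++ (l :: blockList bs ++ endList s)) (h : IsLegList ks)
    (hts : 4 ≤ t ∨ t = 0 ∧ s < 4 ∨ 1 ≤ s ∧ s ≤ t) : Realizable (word ks) := by
  have hr := realizable_caterpillar hl hbs (t := t) (s := s) ?_ hts
  · subst hks
    have hsp : spineTags (l :: blockList bs ++ endList s) =
        true :: (leaves l ++ (blocks bs ++ endRun s)) := by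
      rw [spineTags_append, show l :: blockList bs = [l] ++ blockList bs from rfl,
        spineTags_append, spineTags_blockList, spineTags_endList]
      simp [spineTags]
    rw [word, spineTags_append, hsp]
    cases t with
    | zero => exact hr
    | succ t =>
      rw [startRun, if_neg (by omega), Nat.add_comm (t + 1), run_add] at hr
      refine (Eq.mp (congrArg Realizable ?_) (Realizable.swap hr))
      rw [endList, List.reverse_append, List.reverse_replicate, spineTags_append,
        spineTags_replicate_zero, run_add]
      simp [spineTags]
  · -- a single vertex with legs at one end of the spine would have too large a degree
    rintro rfl rfl
    by_contra hs
    have hs' : s = 0 ∨ s = 1 := by omega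
    rcases hs' with rfl | rfl
    · have := h.two_le
      rw [hks] at this
      simp [endList, blockList] at this
    · have := h.of_length (by rw [hks]; rfl) 1 (by rw [hks]; simp [endList])
      omega

lemma IsLegList.reverse {ks : List ℕ} (h : IsLegList ks) : IsLegList ks.reverse where
  six_le := by simpa using h.six_le
  two_le := by simpa using h.two_le
  of_length := by simpa using h.of_length
  degree as k bs hk := by
    have := h.degree bs.reverse k as.reverse (by
      rw [← List.reverse_reverse ks, hk]; simp)
    simp only [List.length_reverse] at this
    omega

/-- A caterpillar can be read from both ends; from one of them, `realizable_caterpillar`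
applies. -/
lemma IsLegList.realizable {ks : List ℕ} (h : IsLegList ks) :
    Realizable (word ks) ∨ Realizable (word ks.reverse) := by
  obtain ⟨y, ms, x, rfl⟩ : ∃ y ms x, ks = y :: (ms ++ [x]) := by
    rcases ks with _ | ⟨y, ks⟩
    · have := h.two_le; simp at this
    · rcases List.eq_nil_or_concat ks with rfl | ⟨ms, x, rfl⟩
      · have := h.two_le; simp at this
      · exact ⟨y, ms, x, by simp⟩
  have hy : y = 1 ∨ 5 ≤ y := by
    have := h.degree [] y (ms ++ [x]) rfl
    simp only [List.length_nil, List.length_append, List.length_singleton] at this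
    omega
  have hx : x = 1 ∨ 5 ≤ x := by
    have := h.degree (y :: ms) x [] (by simp)
    simp only [List.length_nil, List.length_cons] at this
    omega
  have hm : ∀ k ∈ ms, k = 0 ∨ 5 ≤ k := by
    intro k hk
    obtain ⟨as, bs, rfl⟩ := List.append_of_mem hk
    have := h.degree (y :: as) k (bs ++ [x]) (by simp)
    simp only [List.length_append, List.length_cons, List.length_nil] at this
    omega
  obtain ⟨bs, s, hbs, hks⟩ := exists_eq_blockList_append_endList hm hx
  have key : (∃ t l bs s, 5 ≤ l ∧ (∀ b ∈ bs, 5 ≤ b.2) ∧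
      y :: (ms ++ [x]) = (endList t).reverse ++ (l :: blockList bs ++ endList s)) ∨
      ∃ k, y :: (ms ++ [x]) = 1 :: (List.replicate k 0 ++ [1]) := by
    rcases hy with rfl | hy
    · rcases bs with _ | ⟨⟨r, l⟩, bs⟩
      · right
        rcases s with _ | s
        · simp [blockList, endList] at hks
        · exact ⟨s, by rw [hks]; rfl⟩
      · left
        refine ⟨r + 1, l, bs, s, hbs (r, l) (by simp), fun b hb => hbs b (by simp [hb]), ?_⟩
        rw [hks]
        simp [blockList, endList]
    · exact Or.inl ⟨0, y, bs, s, hy, hbs, by rw [hks]; rfl⟩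
  rcases key with ⟨t, l, bs, s, hl, hbs, hks⟩ | ⟨k, hk⟩
  · by_cases hts : 4 ≤ t ∨ t = 0 ∧ s < 4 ∨ 1 ≤ s ∧ s ≤ t
    · exact Or.inl (realizable_word_of_blocks hl hbs hks h hts)
    · obtain ⟨l', bs', hl', hbs', hrev⟩ := exists_reverse_eq_blockList hbs hl
      refine Or.inr (realizable_word_of_blocks (t := s) (s := t) hl' hbs' ?_ h.reverse (by omega))
      rw [hks, ← hrev]
      simp only [List.reverse_append, List.reverse_reverse, List.append_assoc]
  · left
    have h6 := h.six_le
    rw [hk] at h6 ⊢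
    simp only [List.length_cons, List.length_append, List.length_replicate, List.length_nil,
      List.sum_cons, List.sum_append, List.sum_replicate, List.sum_nil, smul_zero] at h6
    have := realizable_path (k := k + 2) (by omega)
    rw [Nat.add_comm k, show (2 : ℕ) = 1 + 1 from rfl, Nat.add_assoc, run_add,
      List.append_assoc] at this
    refine (Eq.mp (congrArg Realizable ?_) (Realizable.swap this))
    rw [word, show ∀ l : List ℕ, 1 :: l = [1] ++ l from fun _ => rfl, spineTags_append,
      spineTags_append, spineTags_replicate_zero, Nat.add_comm, run_add]
    simp [spineTags]

/-! ### Reading a caterpillar as a tagged list -/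

/-- The tagged list of a caterpillar with the spine `sp` and the leaves `leg v` at `v`, including
the first spine vertex. -/
def attach {V : Type*} (leg : V → List V) (sp : List V) : List (Bool × V) :=
  sp.flatMap fun v => (true, v) :: (leg v).map (Prod.mk false)

lemma map_fst_attach {V : Type*} (leg : V → List V) (sp : List V) :
    (attach leg sp).map Prod.fst = spineTags (sp.map fun v => (leg v).length) := by
  induction sp with
  | nil => rfl
  | cons v sp ih =>
    simp only [attach, spineTags, List.flatMap_cons, List.map_append, List.map_cons] at ih ⊢
    rw [ih]
    simp [Function.comp_def]

lemma map_snd_attach {V : Type*} (leg : V → List V) (sp : List V) :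
    (attach leg sp).map Prod.snd = sp.flatMap fun v => v :: leg v := by
  simp [attach, List.map_flatMap, Function.comp_def]

lemma length_flatMap_cons {V : Type*} (leg : V → List V) (sp : List V) :
    (sp.flatMap fun v => v :: leg v).length =
      sp.length + (sp.map fun v => (leg v).length).sum := by
  induction sp with
  | nil => rfl
  | cons v sp ih =>
    simp only [List.flatMap_cons, List.length_append, ih, List.length_cons, List.map_cons,
      List.sum_cons]
    omega

lemma treeEdges_map_false {V : Type*} (h : V) (l : List V) :
    treeEdges h (l.map (Prod.mk false)) = l.map (Prod.mk h) := by
  induction l with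
  | nil => rfl
  | cons a l ih => simp [treeEdges, ih]

lemma lastHead_map_false {V : Type*} (h : V) (l : List V) :
    lastHead h (l.map (Prod.mk false)) = h := by
  induction l with
  | nil => rfl
  | cons a l ih => simpa [lastHead] using ih

/-- The list `attach` starts with the first spine vertex, which is not attached to anything and
therefore dropped. -/
lemma mem_treeEdges_attach {V : Type*} (leg : V → List V) (v : V) (sp : List V) (e : V × V) :
    e ∈ treeEdges v (attach leg (v :: sp)).tail ↔
      e ∈ pathEdges (v :: sp) ∨ e.1 ∈ v :: sp ∧ e.2 ∈ leg e.1 := by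
  induction sp generalizing v with
  | nil =>
    simp only [attach, List.flatMap_cons, List.flatMap_nil, List.append_nil, List.tail_cons,
      treeEdges_map_false, List.mem_map, List.mem_singleton, pathEdges, List.zip_nil_right,
      List.not_mem_nil, false_or]
    constructor
    · rintro ⟨a, ha, rfl⟩; exact ⟨rfl, ha⟩
    · rintro ⟨rfl, he⟩; exact ⟨e.2, he, rfl⟩
  | cons u sp ih =>
    have hsplit : (attach leg (v :: u :: sp)).tail =
        (leg v).map (Prod.mk false) ++ (true, u) :: (attach leg (u :: sp)).tail := rfl
    rw [hsplit, treeEdges_append, lastHead_map_false, treeEdges_map_false, List.mem_append,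
      treeEdges, if_pos rfl, List.mem_cons, ih u, pathEdges_cons_cons,
      List.mem_cons (a := e) (b := (v, u)),
      List.mem_map, List.mem_cons (a := e.1) (b := v)]
    constructor
    · rintro (⟨a, ha, rfl⟩ | h | h | ⟨h1, h2⟩)
      · exact Or.inr ⟨Or.inl rfl, ha⟩
      · exact Or.inl (Or.inl h)
      · exact Or.inl (Or.inr h)
      · exact Or.inr ⟨Or.inr h1, h2⟩
    · rintro ((h | h) | ⟨rfl | h1, h2⟩)
      · exact Or.inr (Or.inl h)
      · exact Or.inr (Or.inr (Or.inl h))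
      · exact Or.inl ⟨e.2, h2, rfl⟩
      · exact Or.inr (Or.inr (Or.inr ⟨h1, h2⟩))

lemma mem_pathEdges_reverse {V : Type*} {l : List V} {a b : V} :
    (a, b) ∈ pathEdges l.reverse ↔ (b, a) ∈ pathEdges l := by
  suffices h : ∀ (l : List V) (a b : V), (a, b) ∈ pathEdges l → (b, a) ∈ pathEdges l.reverse from
    ⟨fun hab => by simpa using h _ _ _ hab, h _ _ _⟩
  intro l a b hab
  obtain ⟨i, hi, rfl, rfl⟩ := mem_pathEdges_iff.1 hab
  refine mem_pathEdges_iff.2 ⟨l.length - 2 - i, by simp; omega, ?_, ?_⟩ <;>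
    rw [List.getElem_reverse] <;> congr 1 <;> omega

lemma mem_pathEdges_left {V : Type*} {as bs : List V} {v u : V} (h : (as ++ v :: bs).Nodup) :
    (v, u) ∈ pathEdges (as ++ v :: bs) ↔ u ∈ bs.head? := by
  rw [mem_pathEdges_iff]
  constructor
  · rintro ⟨i, hi, h1, h2⟩
    have hi' : i = as.length := by
      refine (h.getElem_inj_iff (hi := by omega) (hj := by simp)).1 (h1.trans ?_)
      simp
    subst hi'
    rw [List.getElem_append_right (by omega)] at h2
    cases bs with
    | nil => simp at hi
    | cons b bs => simpa using h2
  · intro hu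
    cases bs with
    | nil => simp at hu
    | cons b bs =>
      refine ⟨as.length, by simp, by simp, ?_⟩
      rw [List.getElem_append_right (by omega)]
      simpa using hu

lemma mem_pathEdges_right {V : Type*} {as bs : List V} {v u : V} (h : (as ++ v :: bs).Nodup) :
    (u, v) ∈ pathEdges (as ++ v :: bs) ↔ u ∈ as.getLast? := by
  rw [← mem_pathEdges_reverse]
  simp only [List.reverse_append, List.reverse_cons, List.append_assoc, List.singleton_append]
  rw [mem_pathEdges_left, List.head?_reverse]
  simpa using List.nodup_reverse.2 h

/-- The list `sp` consists of the vertices of degree other than one, in the order of a path. -/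
structure IsSpineList {V : Type*} [Fintype V] (T : SimpleGraph V) [DecidableRel T.Adj]
    (sp : List V) : Prop where
  nodup : sp.Nodup
  mem_iff : ∀ v, v ∈ sp ↔ T.degree v ≠ 1
  adj_iff : ∀ a ∈ sp, ∀ b ∈ sp, (T.Adj a b ↔ (a, b) ∈ pathEdges sp ∨ (b, a) ∈ pathEdges sp)

/-- The leaves at the vertex `v`. -/
noncomputable def leavesAt {V : Type*} [Fintype V] (T : SimpleGraph V) [DecidableRel T.Adj]
    (v : V) : List V :=
  (Finset.univ.filter fun u => T.Adj v u ∧ T.degree u = 1).toList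

section

variable {V : Type*} [Fintype V] {T : SimpleGraph V} [DecidableRel T.Adj] {sp : List V}

lemma mem_leavesAt {v u : V} : u ∈ leavesAt T v ↔ T.Adj v u ∧ T.degree u = 1 := by
  simp [leavesAt]

lemma IsCaterpillar.exists_isSpineList (h : IsCaterpillar T) : ∃ sp, IsSpineList T sp := by
  obtain ⟨m, ⟨φ⟩⟩ := h.2
  refine ⟨List.ofFn fun i => (φ.symm i).1, ?_, fun v => ?_, ?_⟩
  · exact List.nodup_ofFn.2 (Subtype.val_injective.comp φ.symm.injective)
  · rw [List.mem_ofFn]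
    constructor
    · rintro ⟨i, rfl⟩; exact (φ.symm i).2
    · intro hv; exact ⟨φ ⟨v, hv⟩, by simp⟩
  · intro a ha b hb
    rw [List.mem_ofFn] at ha hb
    obtain ⟨i, rfl⟩ := ha
    obtain ⟨j, rfl⟩ := hb
    have hinj : ∀ i j : Fin m, (φ.symm i).1 = (φ.symm j).1 ↔ i = j := fun i j =>
      (Subtype.val_injective.comp φ.symm.injective).eq_iff
    have key : ∀ i j : Fin m, ((φ.symm i).1, (φ.symm j).1) ∈
        pathEdges (List.ofFn fun i => (φ.symm i).1) ↔ i.val + 1 = j.val := by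
      intro i j
      rw [mem_pathEdges_iff]
      simp only [List.getElem_ofFn, List.length_ofFn, hinj, Fin.ext_iff]
      constructor
      · rintro ⟨k, hk, rfl, h2⟩; exact h2
      · intro hij; exact ⟨i, by omega, rfl, hij⟩
    rw [key, key, ← pathGraph_adj, ← φ.symm.map_adj_iff]
    rfl

lemma IsSpineList.reverse (h : IsSpineList T sp) : IsSpineList T sp.reverse where
  nodup := List.nodup_reverse.2 h.nodup
  mem_iff v := by rw [List.mem_reverse, h.mem_iff]
  adj_iff a ha b hb := by
    rw [mem_pathEdges_reverse, mem_pathEdges_reverse, or_comm]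
    exact h.adj_iff a (List.mem_reverse.1 ha) b (List.mem_reverse.1 hb)

/-- Besides its leaves, a vertex of the spine is adjacent to the spine vertices before and after
it. -/
lemma IsSpineList.degree_eq (h : IsSpineList T sp) {as bs : List V} {v : V}
    (hsp : sp = as ++ v :: bs) :
    T.degree v = (leavesAt T v).length + min as.length 1 + min bs.length 1 := by
  classical
  have hnd := h.nodup
  rw [hsp] at hnd
  have hv : v ∈ sp := by simp [hsp]
  have hA : ∀ u, u ∈ as.getLast? → u ∈ as := fun u hu => List.mem_of_getLast? hu
  have hB : ∀ u, u ∈ bs.head? → u ∈ bs := fun u hu => List.mem_of_head? hu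
  have hN : T.neighborFinset v =
      (leavesAt T v ++ (as.getLast?.toList ++ bs.head?.toList)).toFinset := by
    ext u
    simp only [mem_neighborFinset, List.mem_toFinset, List.mem_append, mem_leavesAt,
      Option.mem_toList]
    by_cases hu : T.degree u = 1
    · have hu' : u ∉ sp := fun h' => (h.mem_iff u).1 h' hu
      have h1 : u ∉ as.getLast? := fun h' => hu' (by simp [hsp, hA u h'])
      have h2 : u ∉ bs.head? := fun h' => hu' (by simp [hsp, hB u h'])
      simp only [Option.mem_def] at h1 h2
      simp [hu, h1, h2]
    · rw [h.adj_iff v hv u ((h.mem_iff u).2 hu), hsp, mem_pathEdges_left hnd,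
        mem_pathEdges_right hnd]
      simp only [hu, and_false, false_or]
      exact or_comm
  have hlen : (as.getLast?.toList ++ bs.head?.toList).length =
      min as.length 1 + min bs.length 1 := by
    rcases List.eq_nil_or_concat as with rfl | ⟨as, a, rfl⟩ <;> cases bs <;> simp
  rw [← card_neighborFinset_eq_degree, hN, List.toFinset_card_of_nodup, List.length_append, hlen,
    Nat.add_assoc]
  have hdisj : ∀ u ∈ leavesAt T v, u ∉ sp := fun u hu h' => (h.mem_iff u).1 h' (mem_leavesAt.1 hu).2
  refine List.nodup_append.2 ⟨Finset.nodup_toList _, ?_, ?_⟩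
  · refine List.nodup_append.2 ⟨?_, ?_, ?_⟩
    · cases as.getLast? <;> simp
    · cases bs.head? <;> simp
    · intro a ha b hb hab
      have h1 := hA a (by simpa using ha)
      have h2 := hB b (by simpa using hb)
      exact (List.nodup_append.1 hnd).2.2 a h1 b (by simp [h2]) hab
  · intro a ha b hb hab
    subst hab
    refine hdisj a ha ?_
    rw [hsp]
    rcases List.mem_append.1 hb with hb | hb
    · have := hA a (by simpa using hb)
      simp [this]
    · have := hB a (by simpa using hb)
      simp [this]

/-- In a connected graph with at least three vertices, no two vertices of degree one are
adjacent. -/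
lemma degree_ne_one_of_adj (hT : T.Connected) (hV : 3 ≤ Fintype.card V) {u w : V}
    (huw : T.Adj u w) (hu : T.degree u = 1) : T.degree w ≠ 1 := by
  classical
  intro hw
  obtain ⟨u', -, hu'⟩ := degree_eq_one_iff_existsUnique_adj.1 hu
  obtain ⟨w', -, hw'⟩ := degree_eq_one_iff_existsUnique_adj.1 hw
  have hclosed : ∀ a b, T.Walk a b → (a = u ∨ a = w) → (b = u ∨ b = w) := by
    intro a b p
    induction p with
    | nil => exact id
    | cons hab _ ih =>
      rintro (rfl | rfl)
      · exact ih (Or.inr ((hu' _ hab).trans (hu' _ huw).symm))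
      · exact ih (Or.inl ((hw' _ hab).trans (hw' _ huw.symm).symm))
  have hsub : (Finset.univ : Finset V) ⊆ {u, w} := by
    intro x _
    obtain ⟨p⟩ := hT.preconnected u x
    simpa using hclosed u x p (Or.inl rfl)
  have := (Finset.card_le_card hsub).trans Finset.card_le_two
  rw [Finset.card_univ] at this
  omega

lemma IsSpineList.nodup_flatMap (h : IsSpineList T sp) :
    (sp.flatMap fun v => v :: leavesAt T v).Nodup := by
  refine List.nodup_flatMap.2 ⟨fun v hv => List.nodup_cons.2 ⟨fun hv' =>
    (h.mem_iff v).1 hv (mem_leavesAt.1 hv').2, Finset.nodup_toList _⟩, ?_⟩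
  refine h.nodup.imp_of_mem fun {a b} ha hb hab => ?_
  intro u hu1 hu2
  rcases List.mem_cons.1 hu1 with rfl | hu1 <;> rcases List.mem_cons.1 hu2 with rfl | hu2
  · exact hab rfl
  · exact (h.mem_iff u).1 ha (mem_leavesAt.1 hu2).2
  · exact (h.mem_iff u).1 hb (mem_leavesAt.1 hu1).2
  · rw [mem_leavesAt] at hu1 hu2
    obtain ⟨w, -, hw⟩ := degree_eq_one_iff_existsUnique_adj.1 hu1.2
    exact hab ((hw a hu1.1.symm).trans (hw b hu2.1.symm).symm)

lemma IsSpineList.mem_flatMap (h : IsSpineList T sp) (hT : T.Connected)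
    (hV : 3 ≤ Fintype.card V) (u : V) : u ∈ sp.flatMap fun v => v :: leavesAt T v := by
  rw [List.mem_flatMap]
  by_cases hu : T.degree u = 1
  · obtain ⟨w, hw, -⟩ := degree_eq_one_iff_existsUnique_adj.1 hu
    exact ⟨w, (h.mem_iff w).2 (degree_ne_one_of_adj hT hV hw hu),
      List.mem_cons_of_mem _ (mem_leavesAt.2 ⟨hw.symm, hu⟩)⟩
  · exact ⟨u, (h.mem_iff u).2 hu, by simp⟩

lemma IsSpineList.admits (h : IsSpineList T sp) (hT : T.Connected) (hV : 3 ≤ Fintype.card V)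
    {P₁ P₂ : SimpleGraph V} (hP₁ : IsPathGraph P₁) (hP₂ : IsPathGraph P₂)
    (hr : Realizable (word (sp.map fun v => (leavesAt T v).length))) :
    AdmitsOnePlanarPacking ![P₁, P₂, T] := by
  have hcov := h.mem_flatMap hT hV
  have hnd := h.nodup_flatMap
  cases sp with
  | nil =>
    have : Nonempty V := hT.nonempty
    simpa using hcov (Classical.arbitrary V)
  | cons v sp =>
    have hsnd : v :: ((attach (leavesAt T) (v :: sp)).tail).map Prod.snd =
        (v :: sp).flatMap fun v => v :: leavesAt T v := map_snd_attach _ (v :: sp)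
    refine hr.admits hP₁ hP₂ (y₀ := v) (ρ := (attach (leavesAt T) (v :: sp)).tail) ?_
      (hsnd ▸ hnd) (fun u => hsnd ▸ hcov u) fun a b => ?_
    · rw [List.map_tail, map_fst_attach, word]
    · rw [mem_treeEdges_attach, mem_treeEdges_attach]
      simp only [mem_leavesAt]
      constructor
      · intro hab
        by_cases ha : T.degree a = 1
        · have hb := degree_ne_one_of_adj hT hV hab ha
          exact Or.inr (Or.inr ⟨(h.mem_iff b).2 hb, hab.symm, ha⟩)
        · by_cases hb : T.degree b = 1
          · exact Or.inl (Or.inr ⟨(h.mem_iff a).2 ha, hab, hb⟩)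
          · exact ((h.adj_iff a ((h.mem_iff a).2 ha) b ((h.mem_iff b).2 hb)).1 hab).imp
              Or.inl Or.inl
      · have hE : ∀ {a b}, (a, b) ∈ pathEdges (v :: sp) → T.Adj a b := fun {a b} hab =>
          (h.adj_iff a (mem_of_mem_pathEdges hab).1 b (mem_of_mem_pathEdges hab).2).2 (Or.inl hab)
        rintro ((hab | hab) | (hab | hab))
        · exact hE hab
        · exact hab.2.1
        · exact (hE hab).symm
        · exact hab.2.1.symm

lemma IsSpineList.isLegList (h : IsSpineList T sp) (hT : T.Connected)
    (hV : 6 ≤ Fintype.card V) (hdeg : ∀ v, T.degree v ≤ Fintype.card V - 3)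
    (hleg : ∀ v ∈ sp, T.degree v = 2 ∨ 7 ≤ T.degree v) :
    IsLegList (sp.map fun v => (leavesAt T v).length) := by
  classical
  have hcard : Fintype.card V = sp.length + (sp.map fun v => (leavesAt T v).length).sum := by
    rw [← length_flatMap_cons, ← List.toFinset_card_of_nodup h.nodup_flatMap, ← Finset.card_univ]
    congr 1
    symm
    rw [Finset.eq_univ_iff_forall]
    intro u
    exact List.mem_toFinset.2 (h.mem_flatMap hT (by omega) u)
  -- the degree bound, written without the truncated subtraction
  have hmany : ∀ as v bs, sp = as ++ v :: bs →
      (leavesAt T v).length + min as.length 1 + min bs.length 1 + 3 ≤ Fintype.card V := by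
    intro as v bs hsp
    have := hdeg v
    rw [h.degree_eq hsp] at this
    omega
  refine ⟨?_, ?_, ?_, ?_⟩
  · rw [List.length_map]; omega
  · rw [List.length_map]
    rcases sp with _ | ⟨a, _ | ⟨b, sp⟩⟩
    · simp at hcard; omega
    · have := hmany [] a [] rfl
      simp at this hcard
      omega
    · simp
  · intro h2
    rcases sp with _ | ⟨a, _ | ⟨b, _ | ⟨c, sp⟩⟩⟩
    · simp
    · simp at h2
    · have h1 := hmany [] a [b] rfl
      have h2 := hmany [a] b [] rfl
      simp at h1 h2 hcard ⊢
      omega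
    · simp at h2
  · intro as k bs hk
    obtain ⟨as', l, hsp, has, hl⟩ := List.map_eq_append_iff.1 hk
    obtain ⟨v, bs', rfl, hv, hbs⟩ := List.map_eq_cons_iff.1 hl
    have := hleg v (by simp [hsp])
    rw [h.degree_eq hsp] at this
    rw [← has, ← hbs, ← hv, List.length_map, List.length_map]
    exact this

/-- The sufficiency of the two conditions. -/
lemma admits_of_card_and_degree {P₁ P₂ : SimpleGraph V} (hP₁ : IsPathGraph P₁)
    (hP₂ : IsPathGraph P₂) (hT : IsLeggedCaterpillar 5 T) (hV : 6 ≤ Fintype.card V)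
    (hdeg : ∀ v, T.degree v ≤ Fintype.card V - 3) : AdmitsOnePlanarPacking ![P₁, P₂, T] := by
  obtain ⟨sp, h⟩ := hT.1.exists_isSpineList
  have hc : T.Connected := hT.1.1.1
  rcases (h.isLegList hc hV hdeg fun v hv => hT.2 v ((h.mem_iff v).1 hv)).realizable with hr | hr
  · exact h.admits hc (by omega) hP₁ hP₂ hr
  · rw [← List.map_reverse] at hr
    exact h.reverse.admits hc (by omega) hP₁ hP₂ hr

end

end OnePlanarPacking

theorem theorem4 {V : Type*} [Fintype V] (P₁ P₂ T : SimpleGraph V) [DecidableRel T.Adj]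
    (hP₁ : OnePlanarPacking.IsPathGraph P₁) (hP₂ : OnePlanarPacking.IsPathGraph P₂)
    (hT : OnePlanarPacking.IsLeggedCaterpillar 5 T) :
    OnePlanarPacking.AdmitsOnePlanarPacking ![P₁, P₂, T] ↔
      6 ≤ Fintype.card V ∧ ∀ v : V, T.degree v ≤ Fintype.card V - 3 :=
  ⟨OnePlanarPacking.card_and_degree_of_admits hP₁ hP₂ hT,
    fun h => OnePlanarPacking.admits_of_card_and_degree hP₁ hP₂ hT h.1 h.2⟩
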